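/- A Kreweras word of length $3n$ ($n\ge 0$) is a word $w=(w_1,\dots,w_{3n})$ in the letters $A,B,C$, with equally many $A$'s, $B$'s and $C$'s, each of whose prefixes contains at least as many $A$'s as $B$'s and at least as many $A$'s as $C$'s. Write $-B=C$ and $-C=B$. Evacuation. For a poset $P$ with $\ell$ elements, a linear extension is a list $(p_1,\dots,p_\ell)$ of all the elements of $P$, each appearing once, such that $p_i\le p_j$ implies $i\le j$. For $1\le i\le \ell-1$ let $\tau_i$ exchange $p_i$ and $p_{i+1}$ if these are incomparable, and do nothing otherwise. Evacuation of linear extensions of $P$ is $$\mathrm{evac}=(\tau_1)\circ(\tau_2\circ\tau_1)\circ\cdots\circ(\tau_{\ell-1}\circ\cdots\circ\tau_2\circ\tau_1).$$ Let $V(n)=V\times[n]$, where $V=\{A,B,C\}$ is the poset whose only strict relations are $A<B$ and $A<C$, and $[n]$ is the $n$-element chain; write $X_k$ for the element $(X,k)$. Removing the subscripts is a bijection from the linear extensions of $V(n)$ to the Kreweras words of length $3n$, and the evacuation $\mathrm{evac}(w)$ of a Kreweras word $w$ is defined via this bijection. Trip permutation. An arc is a pair $(i,j)$ with $i<j$;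 two arcs $(a,b)$, $(c,d)$ form a crossing if $a\le c<b<d$ (so arcs with the same left endpoint cross). For $\varepsilon\in\{B,C\}$ let $M^\varepsilon_w$ be the unique noncrossing perfect matching of $\{i: w_i\ne-\varepsilon\}$ by arcs whose left endpoints are the $i$ with $w_i=A$ and whose right endpoints are the $i$ with $w_i=\varepsilon$. The bump diagram of $w$ consists of the arcs of $M^B_w\cup M^C_w$, drawn as semicircles above a line carrying the points $1,\dots,3n$. The trip permutation $\sigma_w\in S_{3n}$ is obtained as follows. If $w_i\neq A$, start at $i$ and walk along the unique arc $(i',i)$ towards $i'$; if $w_i=A$, start at $i$ and walk along the arc $(i,i')$ with the smallest $i'$ towards $i'$. At each crossing of arcs $(a,b)$ and $(c,d)$ with $a\le c<b<d$ that is encountered, continue towards $b$ if coming from $a$, towards $a$ if coming from $c$, towards $d$ if coming from $b$, and towards $c$ if coming from $d$. The vertex at which the trip terminates is $\sigma_w(i)$; this defines a permutation. Further, let $\varepsilon_w(i)=w_{\sigma_w(i)}$ if $w_{\sigma_w(i)}\neq A$, and $\varepsilon_w(i)=w_{\sigma_w(\sigma_w(i))}$ if $w_{\sigma_w(i)}=A$;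 this is always $B$ or $C$. For $\sigma\in S_m$ let $\mathrm{rc}(\sigma)=w_0^{-1}\circ\sigma\circ w_0$ be its reverse-complement, where $w_0(i)=m+1-i$. Theorem. Let $w$ be a Kreweras word of length $3n$. Then 1. $\mathrm{evac}(w)=(w_{\sigma_w(3n)},w_{\sigma_w(3n-1)},\dots,w_{\sigma_w(1)})$; 2. $\sigma_{\mathrm{evac}(w)}=\mathrm{rc}(\sigma_w^{-1})$; 3. $\varepsilon_{\mathrm{evac}(w)}=[-\varepsilon_w(3n),-\varepsilon_w(3n-1),\dots,-\varepsilon_w(1)]$, i.e. $\varepsilon_{\mathrm{evac}(w)}(i)=-\varepsilon_w(3n+1-i)$ for $1\le i\le 3n$. -/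

import Mathlib

/-! ### Linear extensions, the involutions `τ`, and evacuation -/

/-- A linear extension of a poset `P` with `ℓ` elements: a list of all elements of `P`, each
appearing once, such that `pᵢ ≤ pⱼ` implies `i ≤ j`. (Positions are numbered from `0`.) -/
@[ext]
structure LinExt (P : Type*) [PartialOrder P] (ℓ : ℕ) where
  seq : Fin ℓ ≃ P
  le_of_le : ∀ i j, seq i ≤ seq j → i ≤ j

namespace LinExt

variable {P : Type*} [PartialOrder P] {ℓ : ℕ}

/-- Exchange the entries in the neighbouring positions `k`, `k + 1`, if these are incomparable. -/
def swapNeighbours (L : LinExt P ℓ) (k : ℕ) (hk : k + 1 < ℓ)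
    (h : ¬ L.seq ⟨k, by omega⟩ ≤ L.seq ⟨k + 1, hk⟩) : LinExt P ℓ where
  seq := (Equiv.swap (⟨k, by omega⟩ : Fin ℓ) ⟨k + 1, hk⟩).trans L.seq
  le_of_le := by
    intro i j hij
    have h1 := L.le_of_le _ _ hij
    by_contra hlt
    simp only [Equiv.trans_apply] at hij
    rw [Equiv.swap_apply_def, Equiv.swap_apply_def] at h1 hij
    split_ifs at h1 hij <;> simp_all [Fin.ext_iff, Fin.le_def] <;> omega

open scoped Classical in
/-- The involution `τ_i` for `1 ≤ i ≤ ℓ - 1`: it exchanges the `i`-th and the `(i+1)`-st entry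
(the positions `i - 1` and `i` when counted from `0`) if they are incomparable. In a linear
extension the `(i+1)`-st entry is never below the `i`-th one, but both are compared here.
For `i` outside that range, the identity. -/
noncomputable def tau (i : ℕ) (L : LinExt P ℓ) : LinExt P ℓ :=
  if hi : 1 ≤ i ∧ i < ℓ then
    if h : ¬ L.seq ⟨i - 1, by omega⟩ ≤ L.seq ⟨i - 1 + 1, by omega⟩ ∧
        ¬ L.seq ⟨i - 1 + 1, by omega⟩ ≤ L.seq ⟨i - 1, by omega⟩ then
      L.swapNeighbours (i - 1) (by omega) h.1
    else L
  else L

/-- `sweep m = τ_m ∘ ⋯ ∘ τ_2 ∘ τ_1`; promotion is `sweep (ℓ - 1)`. -/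
noncomputable def sweep : ℕ → LinExt P ℓ → LinExt P ℓ
  | 0, L => L
  | m + 1, L => tau (m + 1) (sweep m L)

/-- `sweeps m = (τ_1) ∘ (τ_2 ∘ τ_1) ∘ ⋯ ∘ (τ_m ∘ ⋯ ∘ τ_2 ∘ τ_1)`. -/
noncomputable def sweeps : ℕ → LinExt P ℓ → LinExt P ℓ
  | 0, L => L
  | m + 1, L => sweeps m (sweep (m + 1) L)

/-- Evacuation:
`(τ_1) ∘ (τ_2 ∘ τ_1) ∘ ⋯ ∘ (τ_{ℓ-1} ∘ ⋯ ∘ τ_2 ∘ τ_1)`. -/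
noncomputable def evac (L : LinExt P ℓ) : LinExt P ℓ := sweeps (ℓ - 1) L

end LinExt

/-! ### Kreweras words and the poset `V(n)` -/

/-- The letters of Kreweras words; also the elements of the poset `V`. -/
inductive Letter
  | A | B | C
  deriving DecidableEq

instance : Fintype Letter := ⟨{.A, .B, .C}, fun x => by cases x <;> decide⟩

/-- `-B = C` and `-C = B` (with the harmless convention `-A = A`). -/
instance : Neg Letter :=
  ⟨fun x => match x with
    | .A => .A
    | .B => .C
    | .C => .B⟩

/-- The three-element poset `V`, with `A < B` and `A < C`. -/
instance : PartialOrder Letter where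
  le x y := x = y ∨ x = .A
  le_refl _ := Or.inl rfl
  le_trans := by
    rintro x y z (rfl | rfl) (rfl | h)
    · exact Or.inl rfl
    · exact Or.inr h
    · exact Or.inr rfl
    · exact Or.inr rfl
  le_antisymm := by
    rintro x y (h | h) (h' | h')
    · exact h
    · exact h
    · exact h'.symm
    · rw [h, h']

/-- The poset `V(n) = V × [n]`, with the product order. -/
abbrev VPoset (n : ℕ) : Type := Letter × Fin n

/-- The number of letters `x` among the first `k` letters of a word. -/
def prefixCount {m : ℕ} (w : Fin m → Letter) (x : Letter) (k : ℕ) : ℕ :=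
  (Finset.univ.filter fun i : Fin m => i.val < k ∧ w i = x).card

/-- Kreweras words of length `3n`: equally many (hence `n`) letters `A`, `B` and `C`, and every
prefix has at least as many `A`'s as `B`'s and at least as many `A`'s as `C`'s. -/
@[ext]
structure KWord (n : ℕ) where
  letter : Fin (3 * n) → Letter
  total : ∀ x, prefixCount letter x (3 * n) = n
  prefix_B : ∀ k ≤ 3 * n, prefixCount letter .B k ≤ prefixCount letter .A k
  prefix_C : ∀ k ≤ 3 * n, prefixCount letter .C k ≤ prefixCount letter .A k

theorem prefixCount_succ {m : ℕ} (w : Fin m → Letter) (x : Letter) (i : Fin m) :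
    prefixCount w x (i.val + 1) = prefixCount w x i.val + if w i = x then 1 else 0 := by
  unfold prefixCount
  split_ifs with h
  · rw [← Finset.card_insert_of_notMem (a := i) (by simp)]
    congr 1
    ext j
    simp only [Finset.mem_filter, Finset.mem_univ, true_and, Finset.mem_insert, Fin.ext_iff]
    constructor
    · rintro ⟨h1, h2⟩
      by_cases hj : j.val = i.val
      · exact Or.inl hj
      · exact Or.inr ⟨by omega, h2⟩
    · rintro (h1 | ⟨h1, h2⟩)
      · have : j = i := Fin.ext h1
        subst this
        exact ⟨by omega, h⟩
      · exact ⟨by omega, h2⟩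
  · rw [add_zero]
    congr 1
    ext j
    simp only [Finset.mem_filter, Finset.mem_univ, true_and]
    constructor
    · rintro ⟨h1, h2⟩
      refine ⟨?_, h2⟩
      have : j ≠ i := by
        rintro rfl
        exact h h2
      have : j.val ≠ i.val := fun h' => this (Fin.ext h')
      omega
    · rintro ⟨h1, h2⟩
      exact ⟨by omega, h2⟩

theorem prefixCount_mono {m : ℕ} (w : Fin m → Letter) (x : Letter) {k l : ℕ} (h : k ≤ l) :
    prefixCount w x k ≤ prefixCount w x l := by
  apply Finset.card_le_card
  intro j
  simp only [Finset.mem_filter, Finset.mem_univ, true_and]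
  rintro ⟨h1, h2⟩
  exact ⟨by omega, h2⟩

namespace KWord

variable {n : ℕ}

/-- Removing the subscripts from a linear extension of `V(n)` yields a Kreweras word. -/
def ofLinExt (L : LinExt (VPoset n) (3 * n)) : KWord n where
  letter i := (L.seq i).1
  total x := by
    unfold prefixCount
    have : (Finset.univ : Finset (Fin n)).card = n := by simp
    refine Eq.trans ?_ this
    symm
    apply Finset.card_bij (fun k _ => L.seq.symm (x, k))
    · intro k _
      simp
    · intro k _ k' _ h
      simpa using h
    · intro i hi
      simp only [Finset.mem_filter, Finset.mem_univ, true_and] at hi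
      refine ⟨(L.seq i).2, Finset.mem_univ _, ?_⟩
      rw [Equiv.symm_apply_eq, ← hi.2]
  prefix_B k _ := by
    apply Finset.card_le_card_of_injOn (fun i => L.seq.symm (.A, (L.seq i).2))
    · intro i hi
      simp only [Finset.coe_filter, Finset.mem_univ, true_and, Set.mem_ofPred_eq] at hi ⊢
      refine ⟨?_, by simp⟩
      have := L.le_of_le (L.seq.symm (.A, (L.seq i).2)) i
        (by rw [Equiv.apply_symm_apply]; exact ⟨Or.inr rfl, le_refl _⟩)
      have := Fin.le_def.mp this
      omega
    · intro i hi j hj h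
      simp only [Finset.coe_filter, Finset.mem_univ, true_and, Set.mem_ofPred_eq] at hi hj
      simp only [EmbeddingLike.apply_eq_iff_eq, Prod.mk.injEq, true_and] at h
      exact L.seq.injective (Prod.ext (hi.2.trans hj.2.symm) h)
  prefix_C k _ := by
    apply Finset.card_le_card_of_injOn (fun i => L.seq.symm (.A, (L.seq i).2))
    · intro i hi
      simp only [Finset.coe_filter, Finset.mem_univ, true_and, Set.mem_ofPred_eq] at hi ⊢
      refine ⟨?_, by simp⟩
      have := L.le_of_le (L.seq.symm (.A, (L.seq i).2)) i
        (by rw [Equiv.apply_symm_apply]; exact ⟨Or.inr rfl, le_refl _⟩)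
      have := Fin.le_def.mp this
      omega
    · intro i hi j hj h
      simp only [Finset.coe_filter, Finset.mem_univ, true_and, Set.mem_ofPred_eq] at hi hj
      simp only [EmbeddingLike.apply_eq_iff_eq, Prod.mk.injEq, true_and] at h
      exact L.seq.injective (Prod.ext (hi.2.trans hj.2.symm) h)

theorem prefixCount_lt (w : KWord n) (i : Fin (3 * n)) :
    prefixCount w.letter (w.letter i) i.val < n := by
  have h1 := prefixCount_succ w.letter (w.letter i) i
  have h2 := prefixCount_mono w.letter (w.letter i) (show i.val + 1 ≤ 3 * n from i.isLt)
  rw [w.total] at h2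
  simp at h1
  omega

/-- The entry of `V(n)` at position `i`: the letter `wᵢ`, with the number of its earlier
occurrences as a subscript. -/
def entry (w : KWord n) (i : Fin (3 * n)) : VPoset n :=
  (w.letter i, ⟨prefixCount w.letter (w.letter i) i.val, w.prefixCount_lt i⟩)

theorem entry_le (w : KWord n) (i j : Fin (3 * n)) (h : w.entry i ≤ w.entry j) : i ≤ j := by
  by_contra hlt
  rw [not_le, Fin.lt_def] at hlt
  obtain ⟨h1, h2⟩ := h
  have h2 : prefixCount w.letter (w.letter i) i.val ≤
    prefixCount w.letter (w.letter j) j.val := h2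
  have h3 := prefixCount_succ w.letter (w.letter j) j
  have h4 := prefixCount_mono w.letter (w.letter i) (show j.val + 1 ≤ i.val from hlt)
  simp only [if_true] at h3
  rcases h1 with h1 | h1
  · have h1 : w.letter i = w.letter j := h1
    rw [h1] at h2 h4
    omega
  · have h1 : w.letter i = .A := h1
    rw [h1] at h2 h4
    have h5 : prefixCount w.letter (w.letter j) (j.val + 1) ≤
        prefixCount w.letter .A (j.val + 1) := by
      rcases hx : w.letter j with _ | _ | _
      · exact le_refl _
      · exact w.prefix_B _ j.isLt
      · exact w.prefix_C _ j.isLt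
    omega

theorem entry_bijective (w : KWord n) : Function.Bijective w.entry := by
  rw [Fintype.bijective_iff_injective_and_card]
  refine ⟨fun i j h => le_antisymm (w.entry_le i j h.le) (w.entry_le j i h.ge), ?_⟩
  have : Fintype.card Letter = 3 := rfl
  simp [this]

/-- Restoring the subscripts: the linear extension of `V(n)` belonging to a Kreweras word. -/
noncomputable def toLinExt (w : KWord n) : LinExt (VPoset n) (3 * n) where
  seq := Equiv.ofBijective w.entry w.entry_bijective
  le_of_le := w.entry_le

theorem ofLinExt_subscript (L : LinExt (VPoset n) (3 * n)) (i : Fin (3 * n)) :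
    prefixCount (ofLinExt L).letter (L.seq i).1 i.val = (L.seq i).2.val := by
  have hc : (Finset.Iio (L.seq i).2).card = (L.seq i).2.val := by simp
  rw [← hc]
  unfold prefixCount
  symm
  apply Finset.card_bij (fun k _ => L.seq.symm ((L.seq i).1, k))
  · intro k hk
    simp only [Finset.mem_Iio] at hk
    refine Finset.mem_filter.mpr ⟨Finset.mem_univ _, ?_, by simp [ofLinExt]⟩
    have h1 := L.le_of_le (L.seq.symm ((L.seq i).1, k)) i
      (by rw [Equiv.apply_symm_apply]; exact ⟨le_refl _, hk.le⟩)
    have h2 : L.seq.symm ((L.seq i).1, k) ≠ i := by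
      intro h
      rw [Equiv.symm_apply_eq] at h
      rw [← h] at hk
      exact lt_irrefl _ hk
    exact Fin.lt_def.mp (lt_of_le_of_ne h1 h2)
  · intro k _ k' _ h
    simpa using h
  · intro j hj
    have hj : j.val < i.val ∧ (L.seq j).1 = (L.seq i).1 := (Finset.mem_filter.mp hj).2
    refine ⟨(L.seq j).2, ?_, ?_⟩
    · rw [Finset.mem_Iio]
      by_contra hle
      have := Fin.le_def.mp (L.le_of_le i j ⟨hj.2.symm.le, not_lt.mp hle⟩)
      omega
    · rw [Equiv.symm_apply_eq, ← hj.2]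

/-- Removing the subscripts is a bijection from the linear extensions of `V(n)` to the Kreweras
words of length `3n`. -/
noncomputable def linExtEquiv (n : ℕ) : LinExt (VPoset n) (3 * n) ≃ KWord n where
  toFun := ofLinExt
  invFun := toLinExt
  left_inv L := by
    apply LinExt.ext
    ext1 i
    refine Prod.ext rfl (Fin.ext ?_)
    exact ofLinExt_subscript L i
  right_inv w := rfl

/-- Evacuation of Kreweras words, via the bijection with linear extensions of `V(n)`. -/
noncomputable def evac (w : KWord n) : KWord n :=
  linExtEquiv n ((linExtEquiv n).symm w).evac

end KWord

/-! ### Arcs, noncrossing matchings and the Kreweras bump diagram -/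

/-- Arcs are pairs `(i, j)`, where `i < j` will always be imposed. -/
abbrev Arc (m : ℕ) : Type := Fin m × Fin m

/-- The arcs `e = (i, j)` and `f = (k, l)` form a crossing with `i ≤ k < j < l`. -/
def Crosses {m : ℕ} (e f : Arc m) : Prop := e.1 ≤ f.1 ∧ f.1 < e.2 ∧ e.2 < f.2

instance {m : ℕ} (e f : Arc m) : Decidable (Crosses e f) :=
  inferInstanceAs (Decidable (e.1 ≤ f.1 ∧ f.1 < e.2 ∧ e.2 < f.2))

/-- `𝒜` is a noncrossing matching of the set `S`. -/
structure IsNoncrossingMatching {m : ℕ} (𝒜 : Finset (Arc m)) (S : Set (Fin m)) : Prop where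
  arc : ∀ e ∈ 𝒜, e.1 < e.2
  mem : ∀ e ∈ 𝒜, e.1 ∈ S ∧ e.2 ∈ S
  existsUnique : ∀ i ∈ S, ∃! e, e ∈ 𝒜 ∧ (e.1 = i ∨ e.2 = i)
  noncrossing : ∀ e ∈ 𝒜, ∀ f ∈ 𝒜, ¬ Crosses e f

namespace KWord

variable {n : ℕ}

/-- For `ε ∈ {B, C}`: `𝒜` is a noncrossing matching of `{i | wᵢ ≠ -ε}` whose set of openers is
`{i | wᵢ = A}` and whose set of closers is `{i | wᵢ = ε}`. -/
structure IsMatching (w : KWord n) (ε : Letter) (𝒜 : Finset (Arc (3 * n))) : Prop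
    extends IsNoncrossingMatching 𝒜 {i | w.letter i ≠ -ε} where
  openers : {i | ∃ j, (i, j) ∈ 𝒜} = {i | w.letter i = .A}
  closers : {j | ∃ i, (i, j) ∈ 𝒜} = {j | w.letter j = ε}

theorem IsMatching.fst {w : KWord n} {ε : Letter} {𝒜 : Finset (Arc (3 * n))}
    (h : w.IsMatching ε 𝒜) {e : Arc (3 * n)} (he : e ∈ 𝒜) : w.letter e.1 = .A := by
  have : e.1 ∈ {i | ∃ j, (i, j) ∈ 𝒜} := ⟨e.2, he⟩
  rwa [h.openers] at this

theorem IsMatching.snd {w : KWord n} {ε : Letter} {𝒜 : Finset (Arc (3 * n))}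
    (h : w.IsMatching ε 𝒜) {e : Arc (3 * n)} (he : e ∈ 𝒜) : w.letter e.2 = ε := by
  have : e.2 ∈ {j | ∃ i, (i, j) ∈ 𝒜} := ⟨e.1, he⟩
  rwa [h.closers] at this

theorem IsMatching.eq_of_fst {w : KWord n} {ε : Letter} {𝒜 : Finset (Arc (3 * n))}
    (h : w.IsMatching ε 𝒜) {e f : Arc (3 * n)} (he : e ∈ 𝒜) (hf : f ∈ 𝒜) (hef : e.1 = f.1) :
    e = f :=
  (h.existsUnique e.1 (h.mem e he).1).unique ⟨he, Or.inl rfl⟩ ⟨hf, Or.inl hef.symm⟩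

theorem IsMatching.eq_of_snd {w : KWord n} {ε : Letter} {𝒜 : Finset (Arc (3 * n))}
    (h : w.IsMatching ε 𝒜) {e f : Arc (3 * n)} (he : e ∈ 𝒜) (hf : f ∈ 𝒜) (hef : e.2 = f.2) :
    e = f :=
  (h.existsUnique e.2 (h.mem e he).2).unique ⟨he, Or.inr rfl⟩ ⟨hf, Or.inr hef.symm⟩

theorem IsMatching.subset {w : KWord n} {ε : Letter} {𝒜 ℬ : Finset (Arc (3 * n))}
    (h𝒜 : w.IsMatching ε 𝒜) (hℬ : w.IsMatching ε ℬ) :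
    ∀ (j : ℕ) (e : Arc (3 * n)), e.2.val = j → (e ∈ 𝒜 ↔ e ∈ ℬ) := by
  intro j
  induction j using Nat.strong_induction_on with
  | _ j ih =>
    have key : ∀ (𝒜 ℬ : Finset (Arc (3 * n))), w.IsMatching ε 𝒜 → w.IsMatching ε ℬ →
        (∀ m < j, ∀ e : Arc (3 * n), e.2.val = m → (e ∈ 𝒜 ↔ e ∈ ℬ)) →
        ∀ e ∈ 𝒜, ∀ f ∈ ℬ, e.2.val = j → f.2 = e.2 → ¬ e.1 < f.1 := by
      intro 𝒜 ℬ h𝒜 hℬ ih e he f hf hej hfe hlt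
      have h1 : f.1 ∈ {i | w.letter i = .A} := hℬ.fst hf
      rw [← h𝒜.openers] at h1
      obtain ⟨l, hl⟩ := h1
      have hfl := hℬ.arc f hf
      have hne : l ≠ e.2 := by
        rintro rfl
        have := h𝒜.eq_of_snd hl he rfl
        rw [← this] at hlt
        exact lt_irrefl _ hlt
      have hle : l < e.2 := by
        by_contra hge
        exact h𝒜.noncrossing e he _ hl
          ⟨hlt.le, by rw [← hfe]; exact hfl, lt_of_le_of_ne (not_lt.mp hge) hne.symm⟩
      have h2 := (ih l.val (by rw [← hej]; exact hle) (f.1, l) rfl).1 hl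
      have h3 := hℬ.eq_of_fst h2 hf rfl
      rw [← h3] at hfe
      exact hne hfe
    have fin : ∀ (𝒜 ℬ : Finset (Arc (3 * n))), w.IsMatching ε 𝒜 → w.IsMatching ε ℬ →
        (∀ m < j, ∀ e : Arc (3 * n), e.2.val = m → (e ∈ 𝒜 ↔ e ∈ ℬ)) →
        ∀ e ∈ 𝒜, e.2.val = j → e ∈ ℬ := by
      intro 𝒜 ℬ h𝒜 hℬ ih e he hej
      have h1 : e.2 ∈ {i | w.letter i = ε} := h𝒜.snd he
      rw [← hℬ.closers] at h1
      obtain ⟨i, hi⟩ := h1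
      have a1 := key 𝒜 ℬ h𝒜 hℬ ih e he _ hi hej rfl
      have a2 := key ℬ 𝒜 hℬ h𝒜 (fun m hm e he => (ih m hm e he).symm) _ hi e he hej rfl
      have : i = e.1 := le_antisymm (not_lt.mp a1) (not_lt.mp a2)
      rwa [this] at hi
    intro e hej
    exact ⟨fun he => fin 𝒜 ℬ h𝒜 hℬ ih e he hej,
      fun he => fin ℬ 𝒜 hℬ h𝒜 (fun m hm e he => (ih m hm e he).symm) e he hej⟩

/-- The excess of `A`'s over `ε`'s among the first `k` letters. -/
def height (w : KWord n) (ε : Letter) (k : ℕ) : ℤ :=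
  (prefixCount w.letter .A k : ℤ) - prefixCount w.letter ε k

theorem height_succ (w : KWord n) (ε : Letter) (hε : ε ≠ .A) (i : Fin (3 * n)) :
    w.height ε (i.val + 1) = w.height ε i.val +
      if w.letter i = .A then 1 else if w.letter i = ε then -1 else 0 := by
  unfold height
  rw [prefixCount_succ, prefixCount_succ]
  by_cases h : w.letter i = .A
  · simp [h, hε.symm]
    ring
  · by_cases h' : w.letter i = ε
    · simp [h', hε]
      ring
    · simp [h, h']

theorem height_nonneg (w : KWord n) (ε : Letter) (k : ℕ) (hk : k ≤ 3 * n) :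
    0 ≤ w.height ε k := by
  unfold height
  have h1 := w.prefix_B k hk
  have h2 := w.prefix_C k hk
  rcases ε with _ | _ | _ <;> omega

open scoped Classical in
theorem existsUnique_matching (w : KWord n) (ε : Letter) (hε : ε ≠ .A) :
    ∃! 𝒜, w.IsMatching ε 𝒜 := by
  have hstep := w.height_succ ε hε
  have hpos := w.height_nonneg ε
  have hend : w.height ε (3 * n) = 0 := by simp [height, w.total]
  have hzero : w.height ε 0 = 0 := by simp [height, prefixCount]
  let P : Arc (3 * n) → Prop := fun e => w.letter e.1 = .A ∧ w.letter e.2 = ε ∧ e.1 < e.2 ∧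
    w.height ε (e.2.val + 1) = w.height ε e.1.val ∧
    ∀ k, e.1.val < k → k ≤ e.2.val → w.height ε e.1.val < w.height ε k
  have hop : ∀ i, w.letter i = .A → ∃ j, P (i, j) := by
    intro i hi
    have hi1 := hstep i
    rw [if_pos hi] at hi1
    have hex : ∃ k, i.val < k ∧ k ≤ 3 * n ∧ w.height ε k ≤ w.height ε i.val :=
      ⟨3 * n, i.isLt, le_refl _, by rw [hend]; exact hpos _ i.isLt.le⟩
    obtain ⟨h1, h2, h3⟩ := Nat.find_spec hex
    have hmin := fun {m : ℕ} => Nat.find_min hex (m := m)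
    generalize Nat.find hex = k at h1 h2 h3 hmin
    obtain ⟨j, rfl⟩ : ∃ j, k = j + 1 := ⟨k - 1, by omega⟩
    have hji : i.val ≠ j := by
      rintro rfl
      omega
    have hj := hstep ⟨j, by omega⟩
    have hbig : ∀ k, i.val < k → k ≤ j → w.height ε i.val < w.height ε k := by
      intro k hk hkj
      by_contra hle
      exact hmin (show k < j + 1 by omega) ⟨hk, by omega, not_lt.mp hle⟩
    have hj2 := hbig j (by omega) le_rfl
    dsimp only at hj
    refine ⟨⟨j, by omega⟩, hi, ?_, ?_, ?_, hbig⟩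
    · by_contra hne
      rw [if_neg hne] at hj
      split_ifs at hj <;> omega
    · rw [Fin.lt_def]
      dsimp only
      omega
    · dsimp only
      split_ifs at hj <;> omega
  have hcl : ∀ j, w.letter j = ε → ∃ i, P (i, j) := by
    intro j hj
    have hj1 := hstep j
    rw [if_neg (by rw [hj]; exact hε), if_pos hj] at hj1
    have hq0 : w.height ε 0 ≤ w.height ε (j.val + 1) := by
      rw [hzero]
      exact hpos _ j.isLt
    have h1 := Nat.findGreatest_le (P := fun k => w.height ε k ≤ w.height ε (j.val + 1)) j.val
    have h2 := Nat.findGreatest_spec (P := fun k => w.height ε k ≤ w.height ε (j.val + 1))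
      (Nat.zero_le j.val) hq0
    have h3 := fun k => Nat.findGreatest_is_greatest
      (P := fun k => w.height ε k ≤ w.height ε (j.val + 1)) (n := j.val) (k := k)
    generalize Nat.findGreatest (fun k => w.height ε k ≤ w.height ε (j.val + 1)) j.val = i
      at h1 h2 h3
    have hij : i ≠ j.val := by
      rintro rfl
      omega
    have h4 : w.height ε (j.val + 1) < w.height ε (i + 1) :=
      not_le.mp (h3 (i + 1) (by omega) (by omega))
    have hi := hstep ⟨i, by omega⟩
    dsimp only at hi
    have hh : w.letter ⟨i, by omega⟩ = .A := by
      by_contra hne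
      rw [if_neg hne] at hi
      split_ifs at hi <;> omega
    rw [if_pos hh] at hi
    refine ⟨⟨i, by omega⟩, hh, hj, ?_, ?_, ?_⟩
    · rw [Fin.lt_def]
      dsimp only
      omega
    · dsimp only
      omega
    · intro k hk hkj
      have := not_le.mp (h3 k hk hkj)
      dsimp only
      omega
  have hP1 : ∀ e f, P e → P f → e.1 = f.1 → ¬ e.2 < f.2 := by
    rintro ⟨i, j⟩ ⟨i', j'⟩ ⟨_, _, a1, a2, _⟩ ⟨_, _, b1, b2, b3⟩ h hlt
    dsimp only at *
    subst h
    have := b3 (j.val + 1) (by omega) hlt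
    omega
  have hP2 : ∀ e f, P e → P f → e.2 = f.2 → ¬ e.1 < f.1 := by
    rintro ⟨i, j⟩ ⟨i', j'⟩ ⟨_, _, a1, a2, a3⟩ ⟨_, _, b1, b2, b3⟩ h hlt
    dsimp only at *
    subst h
    have := a3 i'.val hlt b1.le
    omega
  have hneg : ∀ x : Letter, x ≠ -ε ↔ (x = .A ∨ x = ε) := by
    intro x
    revert hε
    clear * -
    revert x ε
    decide
  have hM : w.IsMatching ε (Finset.univ.filter P) := by
    refine ⟨⟨?_, ?_, ?_, ?_⟩, ?_, ?_⟩
    · intro e he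
      exact (Finset.mem_filter.mp he).2.2.2.1
    · intro e he
      have := (Finset.mem_filter.mp he).2
      exact ⟨(hneg _).2 (Or.inl this.1), (hneg _).2 (Or.inr this.2.1)⟩
    · intro i hi
      rcases (hneg _).1 hi with hi | hi
      · obtain ⟨j, hj⟩ := hop i hi
        refine ⟨(i, j), ⟨Finset.mem_filter.mpr ⟨Finset.mem_univ _, hj⟩, Or.inl rfl⟩, ?_⟩
        rintro f ⟨hf, hfi⟩
        have hf := (Finset.mem_filter.mp hf).2
        rcases hfi with hfi | hfi
        · exact Prod.ext hfi (le_antisymm (not_lt.mp (hP1 _ _ hj hf hfi.symm))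
            (not_lt.mp (hP1 _ _ hf hj hfi)))
        · exact absurd (hf.2.1.symm.trans ((congrArg _ hfi).trans hi)) hε
      · obtain ⟨j, hj⟩ := hcl i hi
        refine ⟨(j, i), ⟨Finset.mem_filter.mpr ⟨Finset.mem_univ _, hj⟩, Or.inr rfl⟩, ?_⟩
        rintro f ⟨hf, hfi⟩
        have hf := (Finset.mem_filter.mp hf).2
        rcases hfi with hfi | hfi
        · exact absurd (hi.symm.trans ((congrArg _ hfi.symm).trans hf.1)) hε
        · exact Prod.ext (le_antisymm (not_lt.mp (hP2 _ _ hj hf hfi.symm))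
            (not_lt.mp (hP2 _ _ hf hj hfi))) hfi
    · intro e he f hf hc
      obtain ⟨_, _, a1, a2, a3⟩ := (Finset.mem_filter.mp he).2
      have hf' := (Finset.mem_filter.mp hf).2
      have hf2 := hf'
      obtain ⟨_, _, b1, b2, b3⟩ := hf2
      obtain ⟨c1, c2, c3⟩ := hc
      rcases lt_or_eq_of_le c1 with c1 | c1
      · have x1 := a3 f.1.val c1 c2.le
        have x2 := b3 (e.2.val + 1) (by omega) c3
        omega
      · exact hP1 _ _ (Finset.mem_filter.mp he).2 hf' c1 c3
    · ext i
      constructor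
      · rintro ⟨j, hj⟩
        exact (Finset.mem_filter.mp hj).2.1
      · intro hi
        obtain ⟨j, hj⟩ := hop i hi
        exact ⟨j, Finset.mem_filter.mpr ⟨Finset.mem_univ _, hj⟩⟩
    · ext i
      constructor
      · rintro ⟨j, hj⟩
        exact (Finset.mem_filter.mp hj).2.2.1
      · intro hi
        obtain ⟨j, hj⟩ := hcl i hi
        exact ⟨j, Finset.mem_filter.mpr ⟨Finset.mem_univ _, hj⟩⟩
  refine ⟨_, hM, fun ℬ hℬ => ?_⟩
  ext e
  exact IsMatching.subset hℬ hM e.2.val e rfl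

/-- The noncrossing matching `M^ε_w`, for `ε ∈ {B, C}`. -/
noncomputable def matching (w : KWord n) (ε : Letter) (hε : ε ≠ .A) : Finset (Arc (3 * n)) :=
  (w.existsUnique_matching ε hε).choose

theorem isMatching_matching (w : KWord n) (ε : Letter) (hε : ε ≠ .A) :
    w.IsMatching ε (w.matching ε hε) :=
  (w.existsUnique_matching ε hε).choose_spec.1

/-- The arcs of the Kreweras bump diagram of `w`. -/
noncomputable def bumpDiagram (w : KWord n) : Finset (Arc (3 * n)) :=
  w.matching .B (by decide) ∪ w.matching .C (by decide)

end KWord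

/-! ### Trips

The arcs of a bump diagram are drawn as semicircles above a line, so two arcs meet if and only if
they form a crossing, and then exactly once. All arcs crossing a given arc `e = (i, j)` belong to
the noncrossing matching of the other colour, so they do not meet each other. Such an arc `f`
either starts at a place `k` with `i ≤ k < j` and ends beyond `j`, or starts at or before `i` and
ends at a place `l` with `i < l < j`. Since the arcs `f` do not meet each other, the
crossings on `e` appear along `e` from left to right in the order of these places `k` and `l`. -/

/-- For two arcs `e` and `f` that form a crossing: the endpoint of `f` below `e` described above,
which marks the place of the crossing on `e`. -/
def mark {m : ℕ} (e f : Arc m) : Fin m :=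
  if Crosses e f then f.1 else f.2

/-- The direction of walking along an arc `(i, j)`: towards `i`, or towards `j`. -/
inductive Dir
  | left | right
  deriving DecidableEq

instance : Fintype Dir := ⟨{.left, .right}, fun x => by cases x <;> decide⟩

/-- A traveller: on the arc `arc`, walking in direction `dir`, and just having left the place `pos`
(either the vertex at which the trip began, or the mark of a crossing on `arc`). -/
@[ext]
structure Traveller (m : ℕ) where
  arc : Arc m
  dir : Dir
  pos : Fin m

namespace Traveller

variable {m : ℕ}

/-- Whether `p` is still ahead of the traveller. -/
def Ahead (s : Traveller m) (p : Fin m) : Prop :=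
  match s.dir with
  | .left => p < s.pos
  | .right => s.pos < p

/-- The arc `f` of `D` forms a crossing with the current arc which is still ahead. -/
def CrossingAhead (D : Finset (Arc m)) (s : Traveller m) (f : Arc m) : Prop :=
  f ∈ D ∧ (Crosses s.arc f ∨ Crosses f s.arc) ∧ s.Ahead (mark s.arc f)

/-- The crossing with the arc `f` is the next one that the traveller encounters. -/
def NextCrossing (D : Finset (Arc m)) (s : Traveller m) (f : Arc m) : Prop :=
  s.CrossingAhead D f ∧ ∀ g, s.CrossingAhead D g →
    match s.dir with
    | .left => mark s.arc g ≤ mark s.arc f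
    | .right => mark s.arc f ≤ mark s.arc g

/-- The rules of the road at a crossing of `(a, b)` and `(c, d)` with `a ≤ c < b < d`. -/
inductive Step (D : Finset (Arc m)) : Traveller m → Traveller m → Prop
  /-- Coming from `a`, continue towards `b`. -/
  | from_a (ab cd : Arc m) (p : Fin m) : Crosses ab cd →
      NextCrossing D ⟨ab, .right, p⟩ cd → Step D ⟨ab, .right, p⟩ ⟨ab, .right, mark ab cd⟩
  /-- Coming from `c`, continue towards `a`. -/
  | from_c (ab cd : Arc m) (p : Fin m) : Crosses ab cd →
      NextCrossing D ⟨cd, .right, p⟩ ab → Step D ⟨cd, .right, p⟩ ⟨ab, .left, mark ab cd⟩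
  /-- Coming from `b`, continue towards `d`. -/
  | from_b (ab cd : Arc m) (p : Fin m) : Crosses ab cd →
      NextCrossing D ⟨ab, .left, p⟩ cd → Step D ⟨ab, .left, p⟩ ⟨cd, .right, mark cd ab⟩
  /-- Coming from `d`, continue towards `c`. -/
  | from_d (ab cd : Arc m) (p : Fin m) : Crosses ab cd →
      NextCrossing D ⟨cd, .left, p⟩ ab → Step D ⟨cd, .left, p⟩ ⟨cd, .left, mark cd ab⟩

/-- The beginning of the trip at `i`: if `i` is a closer, walk along the arc `(i', i)` towards `i'`;
if `i` is an opener, walk towards `i'` along the arc `(i, i')` with the smallest `i'`. -/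
inductive IsStart (D : Finset (Arc m)) (i : Fin m) : Traveller m → Prop
  | closer (i' : Fin m) : (i', i) ∈ D → IsStart D i ⟨(i', i), .left, i⟩
  | opener (i' : Fin m) : (i, i') ∈ D → (∀ k, (i, k) ∈ D → i' ≤ k) →
      IsStart D i ⟨(i, i'), .right, i⟩

/-- The endpoint of the current arc which the traveller is walking towards. -/
def target (s : Traveller m) : Fin m :=
  match s.dir with
  | .left => s.arc.1
  | .right => s.arc.2

/-- The trip terminates: no crossing is left before the endpoint `j` of the current arc. -/
def IsEnd (D : Finset (Arc m)) (j : Fin m) (s : Traveller m) : Prop :=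
  s.target = j ∧ ∀ f, ¬ s.CrossingAhead D f

end Traveller

/-- The trip starting at `i` terminates at `j`. -/
def IsTrip {m : ℕ} (D : Finset (Arc m)) (i j : Fin m) : Prop :=
  ∃ s t, Traveller.IsStart D i s ∧ Relation.ReflTransGen (Traveller.Step D) s t ∧
    Traveller.IsEnd D j t

/-! ### The trip permutation -/

theorem exists_terminal {X : Type*} [Finite X] (R : X → X → Prop)
    (hl : ∀ a b c, R a c → R b c → a = b) (s : X) (hs : ∀ a, ¬ R a s) :
    ∃ t, Relation.ReflTransGen R s t ∧ ∀ u, ¬ R t u := by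
  by_contra hcon
  push Not at hcon
  choose! next hnext using hcon
  let g : {t // Relation.ReflTransGen R s t} → {t // Relation.ReflTransGen R s t} :=
    fun t => ⟨next t.1, t.2.tail (hnext t.1 t.2)⟩
  have hg : Function.Injective g := by
    intro a b hab
    have h1 := hnext a.1 a.2
    have h2 := hnext b.1 b.2
    have h3 : next a.1 = next b.1 := congrArg Subtype.val hab
    rw [← h3] at h2
    exact Subtype.ext (hl _ _ _ h1 h2)
  obtain ⟨a, ha⟩ := (Finite.injective_iff_surjective.mp hg) ⟨s, .refl⟩
  have h1 := hnext a.1 a.2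
  have h3 : next a.1 = s := congrArg Subtype.val ha
  rw [h3] at h1
  exact hs _ h1

theorem source_unique {X : Type*} (R : X → X → Prop)
    (hl : ∀ a b c, R a c → R b c → a = b) (s s' t : X) (hs : ∀ a, ¬ R a s) (hs' : ∀ a, ¬ R a s')
    (h : Relation.ReflTransGen R s t) (h' : Relation.ReflTransGen R s' t) : s = s' := by
  induction h with
  | refl =>
    rcases Relation.ReflTransGen.cases_tail h' with h | ⟨c, _, hc⟩
    · exact h
    · exact absurd hc (hs _)
  | tail hab hbc ih =>
    rcases Relation.ReflTransGen.cases_tail h' with h | ⟨c, h1, hc⟩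
    · subst h
      exact absurd hbc (hs' _)
    · have := hl _ _ _ hbc hc
      subst this
      exact ih h1

theorem terminal_unique {X : Type*} (R : X → X → Prop)
    (hr : ∀ a b c, R a b → R a c → b = c) (s t t' : X) (ht : ∀ a, ¬ R t a) (ht' : ∀ a, ¬ R t' a)
    (h : Relation.ReflTransGen R s t) (h' : Relation.ReflTransGen R s t') : t = t' := by
  refine source_unique (Function.swap R) (fun a b c h1 h2 => hr _ _ _ h1 h2) t t' s ht ht' ?_ ?_
  · exact Relation.reflTransGen_swap.mpr h
  · exact Relation.reflTransGen_swap.mpr h'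

/-- The properties of the arcs of a bump diagram that make the trips a permutation. -/
structure IsTwoColourable {m : ℕ} (D : Finset (Arc m)) : Prop where
  arc : ∀ e ∈ D, e.1 < e.2
  ne : ∀ e ∈ D, ∀ f ∈ D, e.1 ≠ f.2
  snd : ∀ e ∈ D, ∀ f ∈ D, e.2 = f.2 → e = f
  cover : ∀ i, ∃ e ∈ D, e.1 = i ∨ e.2 = i
  colour : ∀ e ∈ D, ∀ f ∈ D, ∀ g ∈ D, (Crosses e f ∨ Crosses f e) → (Crosses e g ∨ Crosses g e) →
    ¬ Crosses f g

theorem KWord.isTwoColourable {n : ℕ} (w : KWord n) : IsTwoColourable w.bumpDiagram := by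
  have hB := w.isMatching_matching .B (by decide)
  have hC := w.isMatching_matching .C (by decide)
  have hmem : ∀ e, e ∈ w.bumpDiagram ↔
      (e ∈ w.matching .B (by decide) ∨ e ∈ w.matching .C (by decide)) := fun e => Finset.mem_union
  refine ⟨?_, ?_, ?_, ?_, ?_⟩
  · intro e he
    rcases (hmem e).1 he with he | he
    · exact hB.arc e he
    · exact hC.arc e he
  · intro e he f hf h
    have h1 : w.letter e.1 = .A := by
      rcases (hmem e).1 he with he | he
      · exact hB.fst he
      · exact hC.fst he
    rw [h] at h1
    rcases (hmem f).1 hf with hf | hf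
    · rw [hB.snd hf] at h1
      cases h1
    · rw [hC.snd hf] at h1
      cases h1
  · intro e he f hf h
    have h0 := congrArg w.letter h
    rcases (hmem e).1 he with he | he <;> rcases (hmem f).1 hf with hf | hf
    · exact hB.eq_of_snd he hf h
    · rw [hB.snd he, hC.snd hf] at h0
      cases h0
    · rw [hC.snd he, hB.snd hf] at h0
      cases h0
    · exact hC.eq_of_snd he hf h
  · intro i
    by_cases hi : w.letter i = .C
    · obtain ⟨e, ⟨he, hei⟩, _⟩ := hC.existsUnique i (by rw [Set.mem_ofPred_eq, hi]; decide)
      exact ⟨e, (hmem e).2 (Or.inr he), hei⟩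
    · obtain ⟨e, ⟨he, hei⟩, _⟩ := hB.existsUnique i hi
      exact ⟨e, (hmem e).2 (Or.inl he), hei⟩
  · intro e he f hf g hg hef heg hfg
    have xB := hB.noncrossing
    have xC := hC.noncrossing
    rcases (hmem e).1 he with he | he <;> rcases (hmem f).1 hf with hf | hf <;>
      rcases (hmem g).1 hg with hg | hg
    · exact xB f hf g hg hfg
    · exact hef.elim (xB e he f hf) (xB f hf e he)
    · exact heg.elim (xB e he g hg) (xB g hg e he)
    · exact xC f hf g hg hfg
    · exact xB f hf g hg hfg
    · exact heg.elim (xC e he g hg) (xC g hg e he)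
    · exact hef.elim (xC e he f hf) (xC f hf e he)
    · exact xC f hf g hg hfg

theorem mark_of_crosses {m : ℕ} {e f : Arc m} (h : Crosses e f) : mark e f = f.1 := if_pos h

theorem mark_of_crosses' {m : ℕ} {e f : Arc m} (h : Crosses f e) : mark e f = f.2 :=
  if_neg fun h' => lt_asymm h.2.2 h'.2.2

namespace Traveller

variable {m : ℕ} {D : Finset (Arc m)}

instance : Finite (Traveller m) :=
  Finite.of_injective (fun s => (s.arc, s.dir, s.pos)) fun s t h => by
    simp only [Prod.mk.injEq] at h
    exact Traveller.ext h.1 h.2.1 h.2.2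

/-- Consistent positions of a traveller. -/
def Valid (D : Finset (Arc m)) (s : Traveller m) : Prop :=
  s.arc ∈ D ∧
    match s.dir with
    | .left => s.arc.1 < s.pos ∧ (s.pos = s.arc.2 ∨
        ∃ f ∈ D, (Crosses s.arc f ∨ Crosses f s.arc) ∧ mark s.arc f = s.pos)
    | .right => (s.pos = s.arc.1 ∧ ∀ f ∈ D, f.1 = s.arc.1 → s.arc.2 ≤ f.2) ∨
        ∃ f ∈ D, (Crosses s.arc f ∨ Crosses f s.arc) ∧ mark s.arc f = s.pos

theorem mark_bounds {e f : Arc m} (_ : e ∈ D) (_ : f ∈ D)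
    (h : Crosses e f ∨ Crosses f e) : e.1 ≤ mark e f ∧ mark e f < e.2 := by
  rcases h with h | h
  · rw [mark_of_crosses h]
    exact ⟨h.1, h.2.1⟩
  · rw [mark_of_crosses' h]
    exact ⟨h.2.1.le, h.2.2⟩

theorem eq_of_fst (hD : IsTwoColourable D) {e f g : Arc m} (he : e ∈ D) (hf : f ∈ D) (hg : g ∈ D)
    (h : Crosses e f ∨ Crosses f e) (h' : Crosses e g ∨ Crosses g e) (hfg : f.1 = g.1) :
    f = g := by
  rcases lt_trichotomy f.2 g.2 with hlt | heq | hlt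
  · exact absurd ⟨hfg.le, by rw [← hfg]; exact hD.arc f hf, hlt⟩ (hD.colour e he f hf g hg h h')
  · exact Prod.ext hfg heq
  · exact absurd ⟨hfg.ge, by rw [hfg]; exact hD.arc g hg, hlt⟩ (hD.colour e he g hg f hf h' h)

theorem eq_of_mark (hD : IsTwoColourable D) {e f g : Arc m} (he : e ∈ D) (hf : f ∈ D) (hg : g ∈ D)
    (h : Crosses e f ∨ Crosses f e) (h' : Crosses e g ∨ Crosses g e)
    (hfg : mark e f = mark e g) : f = g := by
  rcases id h with a | a <;> rcases id h' with b | b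
  · rw [mark_of_crosses a, mark_of_crosses b] at hfg
    exact eq_of_fst hD he hf hg h h' hfg
  · rw [mark_of_crosses a, mark_of_crosses' b] at hfg
    exact absurd hfg (hD.ne f hf g hg)
  · rw [mark_of_crosses' a, mark_of_crosses b] at hfg
    exact absurd hfg.symm (hD.ne g hg f hf)
  · rw [mark_of_crosses' a, mark_of_crosses' b] at hfg
    exact hD.snd f hf g hg hfg

theorem next_unique (hD : IsTwoColourable D) {s : Traveller m} (hs : s.arc ∈ D) {f g : Arc m}
    (hf : s.NextCrossing D f) (hg : s.NextCrossing D g) : f = g := by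
  obtain ⟨e, d, p⟩ := s
  refine eq_of_mark hD hs hf.1.1 hg.1.1 hf.1.2.1 hg.1.2.1 ?_
  have h1 := hf.2 g hg.1
  have h2 := hg.2 f hf.1
  cases d <;> exact le_antisymm (by assumption) (by assumption)

theorem exists_next {s : Traveller m} (h : ∃ f, s.CrossingAhead D f) :
    ∃ f, s.NextCrossing D f := by
  classical
  obtain ⟨e, d, p⟩ := s
  have hne : (D.filter fun f => CrossingAhead D ⟨e, d, p⟩ f).Nonempty := by
    obtain ⟨f, hf⟩ := h
    exact ⟨f, Finset.mem_filter.mpr ⟨hf.1, hf⟩⟩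
  cases d
  · obtain ⟨f, hf, hmax⟩ := Finset.exists_max_image _ (fun f => mark e f) hne
    exact ⟨f, (Finset.mem_filter.mp hf).2,
      fun g hg => hmax g (Finset.mem_filter.mpr ⟨hg.1, hg⟩)⟩
  · obtain ⟨f, hf, hmin⟩ := Finset.exists_min_image _ (fun f => mark e f) hne
    exact ⟨f, (Finset.mem_filter.mp hf).2,
      fun g hg => hmin g (Finset.mem_filter.mpr ⟨hg.1, hg⟩)⟩

theorem exists_step {s : Traveller m} (h : ∃ f, s.CrossingAhead D f) : ∃ t, Step D s t := by
  obtain ⟨f, hf⟩ := exists_next h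
  obtain ⟨e, d, p⟩ := s
  rcases id hf.1.2.1 with hc | hc <;> cases d
  · exact ⟨_, .from_b e f p hc hf⟩
  · exact ⟨_, .from_a e f p hc hf⟩
  · exact ⟨_, .from_d f e p hc hf⟩
  · exact ⟨_, .from_c f e p hc hf⟩

theorem Step.valid (hD : IsTwoColourable D) {s t : Traveller m} (hs : s.Valid D)
    (h : Step D s t) : t.Valid D := by
  cases h with
  | from_a ab cd p hc hn =>
    exact ⟨hs.1, Or.inr ⟨cd, hn.1.1, Or.inl hc, rfl⟩⟩
  | from_c ab cd p hc hn =>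
    have hab := hn.1.1
    refine ⟨hab, ?_, Or.inr ⟨cd, hs.1, Or.inl hc, rfl⟩⟩
    dsimp only
    have hahead : p < mark cd ab := hn.1.2.2
    rw [mark_of_crosses' hc] at hahead
    rw [mark_of_crosses hc]
    refine lt_of_le_of_ne hc.1 fun heq => ?_
    rcases hs.2 with ⟨h1, h2⟩ | ⟨g, hg, h1, h2⟩
    · exact absurd hc.2.2 (not_lt.mpr (h2 ab hab heq))
    · dsimp only at h1 h2
      have hab' : Crosses cd ab ∨ Crosses ab cd := Or.inr hc
      rcases id h1 with hx | hx
      · rw [mark_of_crosses hx] at h2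
        have : Crosses ab g := ⟨by rw [heq]; exact hx.1, by rw [h2]; exact hahead,
          hc.2.2.trans hx.2.2⟩
        exact hD.colour cd hs.1 ab hab g hg hab' h1 this
      · rw [mark_of_crosses' hx] at h2
        have : Crosses g ab := ⟨by rw [heq]; exact hx.1, by rw [heq]; exact hx.2.1,
          by rw [h2]; exact hahead⟩
        exact hD.colour cd hs.1 g hg ab hab h1 hab' this
  | from_b ab cd p hc hn =>
    exact ⟨hn.1.1, Or.inr ⟨ab, hs.1, Or.inr hc, rfl⟩⟩
  | from_d ab cd p hc hn =>
    refine ⟨hs.1, ?_, Or.inr ⟨ab, hn.1.1, Or.inr hc, rfl⟩⟩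
    dsimp only
    rw [mark_of_crosses' hc]
    exact hc.2.1

theorem pos_unique_right {e : Arc m} {p p' : Fin m} {f f' : Arc m}
    (hp : Valid D ⟨e, .right, p⟩) (hp' : Valid D ⟨e, .right, p'⟩)
    (hf : NextCrossing D ⟨e, .right, p⟩ f) (hf' : NextCrossing D ⟨e, .right, p'⟩ f')
    (hff : mark e f = mark e f') : p = p' := by
  have key : ∀ {p p' f f'}, Valid D ⟨e, .right, p⟩ → Valid D ⟨e, .right, p'⟩ →
      NextCrossing D ⟨e, .right, p⟩ f → NextCrossing D ⟨e, .right, p'⟩ f' →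
      mark e f = mark e f' → ¬ p < p' := by
    intro p p' f f' hp hp' hf hf' hff hlt
    have hle : e.1 ≤ p := by
      rcases hp.2 with h | ⟨g, hg, h1, h2⟩
      · exact h.1.ge
      · exact (show mark e g = p from h2) ▸ (mark_bounds hp.1 hg h1).1
    rcases hp'.2 with h | ⟨g, hg, h1, h2⟩
    · have h1 : p' = e.1 := h.1
      exact absurd hlt (not_lt.mpr (h1 ▸ hle))
    · have h3 : mark e f ≤ mark e g := hf.2 g ⟨hg, h1, show p < mark e g from h2.symm ▸ hlt⟩
      have h4 : p' < mark e f' := hf'.1.2.2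
      have h2 : mark e g = p' := h2
      rw [hff, h2] at h3
      exact absurd h4 (not_lt.mpr h3)
  exact le_antisymm (not_lt.mp (key hp' hp hf' hf hff.symm)) (not_lt.mp (key hp hp' hf hf' hff))

theorem pos_unique_left {e : Arc m} {p p' : Fin m} {f f' : Arc m}
    (hp : Valid D ⟨e, .left, p⟩) (hp' : Valid D ⟨e, .left, p'⟩)
    (hf : NextCrossing D ⟨e, .left, p⟩ f) (hf' : NextCrossing D ⟨e, .left, p'⟩ f')
    (hff : mark e f = mark e f') : p = p' := by
  have key : ∀ {p p' f f'}, Valid D ⟨e, .left, p⟩ → Valid D ⟨e, .left, p'⟩ →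
      NextCrossing D ⟨e, .left, p⟩ f → NextCrossing D ⟨e, .left, p'⟩ f' →
      mark e f = mark e f' → ¬ p' < p := by
    intro p p' f f' hp hp' hf hf' hff hlt
    have hle : p ≤ e.2 := by
      rcases hp.2.2 with h | ⟨g, hg, h1, h2⟩
      · exact h.le
      · exact (show mark e g = p from h2) ▸ (mark_bounds hp.1 hg h1).2.le
    rcases hp'.2.2 with h | ⟨g, hg, h1, h2⟩
    · have h1 : p' = e.2 := h
      exact absurd hlt (not_lt.mpr (h1 ▸ hle))
    · have h3 : mark e g ≤ mark e f := hf.2 g ⟨hg, h1, show mark e g < p from h2.symm ▸ hlt⟩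
      have h4 : mark e f' < p' := hf'.1.2.2
      have h2 : mark e g = p' := h2
      rw [hff, h2] at h3
      exact absurd h4 (not_lt.mpr h3)
  exact le_antisymm (not_lt.mp (key hp hp' hf hf' hff)) (not_lt.mp (key hp' hp hf' hf hff.symm))

theorem step_left_unique (hD : IsTwoColourable D) {s s' t : Traveller m} (hs : s.Valid D)
    (hs' : s'.Valid D) (h : Step D s t) (h' : Step D s' t) : s = s' := by
  generalize ht : t = t' at h'
  cases h with
  | from_a ab cd p hc hn =>
    cases h' with
    | from_a ab' cd' p' hc' hn' =>
      obtain ⟨rfl, -, hq⟩ := Traveller.mk.inj ht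
      rw [pos_unique_right hs hs' hn hn' hq]
    | from_b ab' cd' p' hc' hn' =>
      obtain ⟨rfl, -, hq⟩ := Traveller.mk.inj ht
      rw [mark_of_crosses hc, mark_of_crosses' hc'] at hq
      exact absurd hq (hD.ne _ hn.1.1 _ hs'.1)
    | from_c => exact absurd (Traveller.mk.inj ht).2.1 (by decide)
    | from_d => exact absurd (Traveller.mk.inj ht).2.1 (by decide)
  | from_b ab cd p hc hn =>
    cases h' with
    | from_a ab' cd' p' hc' hn' =>
      obtain ⟨rfl, -, hq⟩ := Traveller.mk.inj ht
      rw [mark_of_crosses' hc, mark_of_crosses hc'] at hq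
      exact absurd hq.symm (hD.ne _ hn'.1.1 _ hs.1)
    | from_b ab' cd' p' hc' hn' =>
      obtain ⟨rfl, -, hq⟩ := Traveller.mk.inj ht
      rw [mark_of_crosses' hc, mark_of_crosses' hc'] at hq
      obtain rfl := hD.snd _ hs.1 _ hs'.1 hq
      rw [pos_unique_left hs hs' hn hn' rfl]
    | from_c => exact absurd (Traveller.mk.inj ht).2.1 (by decide)
    | from_d => exact absurd (Traveller.mk.inj ht).2.1 (by decide)
  | from_c ab cd p hc hn =>
    cases h' with
    | from_c ab' cd' p' hc' hn' =>
      obtain ⟨rfl, -, hq⟩ := Traveller.mk.inj ht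
      rw [mark_of_crosses hc, mark_of_crosses hc'] at hq
      obtain rfl := eq_of_fst hD hn.1.1 hs.1 hs'.1 (Or.inl hc) (Or.inl hc') hq
      rw [pos_unique_right hs hs' hn hn' rfl]
    | from_d ab' cd' p' hc' hn' =>
      obtain ⟨rfl, -, hq⟩ := Traveller.mk.inj ht
      rw [mark_of_crosses hc, mark_of_crosses' hc'] at hq
      exact absurd hq (hD.ne _ hs.1 _ hn'.1.1)
    | from_a => exact absurd (Traveller.mk.inj ht).2.1 (by decide)
    | from_b => exact absurd (Traveller.mk.inj ht).2.1 (by decide)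
  | from_d ab cd p hc hn =>
    cases h' with
    | from_c ab' cd' p' hc' hn' =>
      obtain ⟨rfl, -, hq⟩ := Traveller.mk.inj ht
      rw [mark_of_crosses' hc, mark_of_crosses hc'] at hq
      exact absurd hq.symm (hD.ne _ hs'.1 _ hn.1.1)
    | from_d ab' cd' p' hc' hn' =>
      obtain ⟨rfl, -, hq⟩ := Traveller.mk.inj ht
      rw [pos_unique_left hs hs' hn hn' hq]
    | from_a => exact absurd (Traveller.mk.inj ht).2.1 (by decide)
    | from_b => exact absurd (Traveller.mk.inj ht).2.1 (by decide)

theorem step_right_unique (hD : IsTwoColourable D) {s t t' : Traveller m} (hs : s.Valid D)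
    (h : Step D s t) (h' : Step D s t') : t = t' := by
  cases h with
  | from_a ab cd p hc hn =>
    cases h' with
    | from_a _ cd' _ hc' hn' => rw [next_unique hD hs.1 hn hn']
    | from_c ab' _ _ hc' hn' =>
      obtain rfl := next_unique hD hs.1 hn hn'
      exact absurd hc.2.2 (lt_asymm hc'.2.2)
  | from_b ab cd p hc hn =>
    cases h' with
    | from_b _ cd' _ hc' hn' => rw [next_unique hD hs.1 hn hn']
    | from_d ab' _ _ hc' hn' =>
      obtain rfl := next_unique hD hs.1 hn hn'
      exact absurd hc.2.2 (lt_asymm hc'.2.2)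
  | from_c ab cd p hc hn =>
    cases h' with
    | from_c ab' _ _ hc' hn' => rw [next_unique hD hs.1 hn hn']
    | from_a _ cd' _ hc' hn' =>
      obtain rfl := next_unique hD hs.1 hn hn'
      exact absurd hc.2.2 (lt_asymm hc'.2.2)
  | from_d ab cd p hc hn =>
    cases h' with
    | from_d ab' _ _ hc' hn' => rw [next_unique hD hs.1 hn hn']
    | from_b _ cd' _ hc' hn' =>
      obtain rfl := next_unique hD hs.1 hn hn'
      exact absurd hc.2.2 (lt_asymm hc'.2.2)

theorem IsStart.valid (hD : IsTwoColourable D) {i : Fin m} {s : Traveller m}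
    (h : IsStart D i s) : s.Valid D := by
  cases h with
  | closer i' h => exact ⟨h, hD.arc _ h, Or.inl rfl⟩
  | opener i' h hmin =>
    refine ⟨h, Or.inl ⟨rfl, ?_⟩⟩
    rintro ⟨a, b⟩ hf rfl
    exact hmin b hf

theorem IsStart.no_pred (hD : IsTwoColourable D) {i : Fin m} {s t : Traveller m}
    (h : IsStart D i s) (ht : t.Valid D) : ¬ Step D t s := by
  intro hstep
  cases h with
  | closer i' h =>
    generalize hu : (⟨(i', i), .left, i⟩ : Traveller m) = u at hstep
    cases hstep with
    | from_c ab cd p hc hn =>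
      have hq := (Traveller.mk.inj hu).2.2
      rw [mark_of_crosses hc] at hq
      exact hD.ne _ ht.1 _ h hq.symm
    | from_d ab cd p hc hn =>
      obtain ⟨rfl, -, hq⟩ := Traveller.mk.inj hu
      rw [mark_of_crosses' hc] at hq
      exact absurd hc.2.2 (not_lt.mpr hq.le)
    | from_a => exact absurd (Traveller.mk.inj hu).2.1 (by decide)
    | from_b => exact absurd (Traveller.mk.inj hu).2.1 (by decide)
  | opener i' h hmin =>
    generalize hu : (⟨(i, i'), .right, i⟩ : Traveller m) = u at hstep
    cases hstep with
    | from_a ab cd p hc hn =>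
      obtain ⟨rfl, -, hq⟩ := Traveller.mk.inj hu
      have h1 : p < mark (i, i') cd := hn.1.2.2
      rw [← hq] at h1
      rcases ht.2 with h2 | ⟨g, hg, h2, h3⟩
      · exact absurd h1 (not_lt.mpr h2.1.ge)
      · have h4 := (mark_bounds ht.1 hg h2).1
        rw [h3] at h4
        exact absurd h1 (not_lt.mpr h4)
    | from_b ab cd p hc hn =>
      have hq := (Traveller.mk.inj hu).2.2
      rw [mark_of_crosses' hc] at hq
      exact hD.ne _ h _ ht.1 hq
    | from_c => exact absurd (Traveller.mk.inj hu).2.1 (by decide)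
    | from_d => exact absurd (Traveller.mk.inj hu).2.1 (by decide)

theorem exists_start (hD : IsTwoColourable D) (i : Fin m) : ∃ s, IsStart D i s := by
  classical
  obtain ⟨⟨a, b⟩, he, rfl | rfl⟩ := hD.cover i
  · have hne : (Finset.univ.filter fun k => ((a, k) : Arc m) ∈ D).Nonempty :=
      ⟨b, Finset.mem_filter.mpr ⟨Finset.mem_univ _, he⟩⟩
    obtain ⟨k, hk, hmin⟩ := Finset.exists_min_image _ id hne
    exact ⟨_, .opener k (Finset.mem_filter.mp hk).2
      fun l hl => hmin l (Finset.mem_filter.mpr ⟨Finset.mem_univ _, hl⟩)⟩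
  · exact ⟨_, .closer a he⟩

theorem start_unique (hD : IsTwoColourable D) {i : Fin m} {s s' : Traveller m}
    (h : IsStart D i s) (h' : IsStart D i s') : s = s' := by
  cases h with
  | closer a ha =>
    cases h' with
    | closer b hb => rw [(Prod.mk.inj (hD.snd _ ha _ hb rfl)).1]
    | opener b hb => exact absurd rfl (hD.ne _ hb _ ha)
  | opener a ha hmin =>
    cases h' with
    | closer b hb => exact absurd rfl (hD.ne _ ha _ hb)
    | opener b hb hmin' => rw [le_antisymm (hmin b hb) (hmin' a ha)]

theorem start_vertex_unique {i i' : Fin m} {s : Traveller m}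
    (h : IsStart D i s) (h' : IsStart D i' s) : i = i' := by
  cases h <;> cases h' <;> rfl

theorem end_unique (hD : IsTwoColourable D) {j : Fin m} {t t' : Traveller m} (ht : t.Valid D)
    (ht' : t'.Valid D) (h : t.IsEnd D j) (h' : t'.IsEnd D j) : t = t' := by
  obtain ⟨e, d, p⟩ := t
  obtain ⟨e', d', p'⟩ := t'
  obtain ⟨h1, h2⟩ := h
  obtain ⟨h1', h2'⟩ := h'
  cases d <;> cases d'
  · have a : e.1 = j := h1
    have a' : e'.1 = j := h1'
    have key : ∀ {e e' : Arc m} {p : Fin m}, Valid D ⟨e, .left, p⟩ → e' ∈ D → e.1 = e'.1 →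
        (∀ f, ¬ CrossingAhead D ⟨e, .left, p⟩ f) → ¬ e.2 < e'.2 := by
      intro e e' p hv he' heq hno hlt
      have hc : Crosses e e' := ⟨heq.le, by rw [← heq]; exact hD.arc e hv.1, hlt⟩
      refine hno e' ⟨he', Or.inl hc, ?_⟩
      show mark e e' < p
      rw [mark_of_crosses hc, ← heq]
      exact hv.2.1
    have hee : e = e' := Prod.ext (a.trans a'.symm) (le_antisymm
      (not_lt.mp (key ht' ht.1 (a'.trans a.symm) h2'))
      (not_lt.mp (key ht ht'.1 (a.trans a'.symm) h2)))
    subst hee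
    have key2 : ∀ {p p' : Fin m}, Valid D ⟨e, .left, p⟩ → Valid D ⟨e, .left, p'⟩ →
        (∀ f, ¬ CrossingAhead D ⟨e, .left, p⟩ f) → ¬ p' < p := by
      intro p p' hv hv' hno hlt
      rcases hv'.2.2 with h | ⟨g, hg, hx, hm⟩
      · have h : p' = e.2 := h
        have hle : p ≤ e.2 := by
          rcases hv.2.2 with h | ⟨g, hg, h1, h2⟩
          · exact h.le
          · exact (show mark e g = p from h2) ▸ (mark_bounds hv.1 hg h1).2.le
        exact absurd hlt (not_lt.mpr (h ▸ hle))
      · exact hno g ⟨hg, hx, show mark e g < p from hm.symm ▸ hlt⟩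
    rw [le_antisymm (not_lt.mp (key2 ht ht' h2)) (not_lt.mp (key2 ht' ht h2'))]
  · exact absurd (h1.trans h1'.symm) (hD.ne _ ht.1 _ ht'.1)
  · exact absurd (h1'.trans h1.symm) (hD.ne _ ht'.1 _ ht.1)
  · obtain rfl := hD.snd _ ht.1 _ ht'.1 (h1.trans h1'.symm)
    have key2 : ∀ {p p' : Fin m}, Valid D ⟨e, .right, p⟩ → Valid D ⟨e, .right, p'⟩ →
        (∀ f, ¬ CrossingAhead D ⟨e, .right, p⟩ f) → ¬ p < p' := by
      intro p p' hv hv' hno hlt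
      rcases hv'.2 with h | ⟨g, hg, hx, hm⟩
      · have h : p' = e.1 := h.1
        have hle : e.1 ≤ p := by
          rcases hv.2 with h | ⟨g, hg, h1, h2⟩
          · exact h.1.ge
          · exact (show mark e g = p from h2) ▸ (mark_bounds hv.1 hg h1).1
        exact absurd hlt (not_lt.mpr (h ▸ hle))
      · exact hno g ⟨hg, hx, show p < mark e g from hm.symm ▸ hlt⟩
    rw [le_antisymm (not_lt.mp (key2 ht' ht h2')) (not_lt.mp (key2 ht ht' h2))]

/-- Steps between consistent positions. -/
def VStep (D : Finset (Arc m)) (s t : Traveller m) : Prop := s.Valid D ∧ Step D s t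

theorem reaches_valid (hD : IsTwoColourable D) {s t : Traveller m} (hs : s.Valid D)
    (h : Relation.ReflTransGen (Step D) s t) :
    Relation.ReflTransGen (VStep D) s t ∧ t.Valid D := by
  induction h with
  | refl => exact ⟨.refl, hs⟩
  | tail _ hbc ih => exact ⟨ih.1.tail ⟨ih.2, hbc⟩, hbc.valid hD ih.2⟩

theorem IsEnd.no_succ {j : Fin m} {t u : Traveller m} (h : t.IsEnd D j) : ¬ Step D t u := by
  intro hs
  cases hs with
  | from_a _ _ _ _ hn => exact h.2 _ hn.1
  | from_b _ _ _ _ hn => exact h.2 _ hn.1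
  | from_c _ _ _ _ hn => exact h.2 _ hn.1
  | from_d _ _ _ _ hn => exact h.2 _ hn.1

end Traveller

open Traveller in
theorem existsUnique_trip {m : ℕ} {D : Finset (Arc m)} (hD : IsTwoColourable D) :
    ∃! σ : Equiv.Perm (Fin m), ∀ i, IsTrip D i (σ i) := by
  have hl : ∀ a b c, VStep D a c → VStep D b c → a = b :=
    fun a b c h1 h2 => step_left_unique hD h1.1 h2.1 h1.2 h2.2
  have hr : ∀ a b c, VStep D a b → VStep D a c → b = c :=
    fun a b c h1 h2 => step_right_unique hD h1.1 h1.2 h2.2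
  have hex : ∀ i, ∃ j, IsTrip D i j := by
    intro i
    obtain ⟨s, hs⟩ := exists_start hD i
    obtain ⟨t, h1, h2⟩ := exists_terminal (VStep D) hl s fun a ha => hs.no_pred hD ha.1 ha.2
    have h3 : Relation.ReflTransGen (Step D) s t := Relation.ReflTransGen.mono (r := VStep D) (p := Step D) (fun _ _ h => h.2) _ _ h1
    refine ⟨t.target, s, t, hs, h3, rfl, fun f hf => ?_⟩
    obtain ⟨u, hu⟩ := exists_step ⟨f, hf⟩
    exact h2 u ⟨(reaches_valid hD (hs.valid hD) h3).2, hu⟩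
  have hdet : ∀ i j j', IsTrip D i j → IsTrip D i j' → j = j' := by
    rintro i j j' ⟨s, t, hs, hst, ht⟩ ⟨s', t', hs', hst', ht'⟩
    obtain rfl := start_unique hD hs hs'
    have := terminal_unique (VStep D) hr s t t' (fun _ h => ht.no_succ h.2)
      (fun _ h => ht'.no_succ h.2) (reaches_valid hD (hs.valid hD) hst).1
      (reaches_valid hD (hs.valid hD) hst').1
    subst this
    exact ht.1.symm.trans ht'.1
  have hinj : ∀ i i' j, IsTrip D i j → IsTrip D i' j → i = i' := by
    rintro i i' j ⟨s, t, hs, hst, ht⟩ ⟨s', t', hs', hst', ht'⟩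
    have r := reaches_valid hD (hs.valid hD) hst
    have r' := reaches_valid hD (hs'.valid hD) hst'
    obtain rfl := end_unique hD r.2 r'.2 ht ht'
    obtain rfl := source_unique (VStep D) hl s s' t (fun a ha => hs.no_pred hD ha.1 ha.2)
      (fun a ha => hs'.no_pred hD ha.1 ha.2) r.1 r'.1
    exact start_vertex_unique hs hs'
  choose g hg using hex
  have hgi : Function.Injective g := fun a b h => hinj a b (g a) (hg a) (h ▸ hg b)
  refine ⟨Equiv.ofBijective g (Finite.injective_iff_bijective.mp hgi), hg, fun σ hσ => ?_⟩
  ext1 i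
  exact hdet i _ _ (hσ i) (hg i)

namespace KWord

variable {n : ℕ}

/-- The trip permutation `σ_w`: the trip in the bump diagram of `w` starting at `i` terminates at
`σ_w i`. -/
noncomputable def tripPerm (w : KWord n) : Equiv.Perm (Fin (3 * n)) :=
  (existsUnique_trip w.isTwoColourable).choose

theorem isTrip_tripPerm (w : KWord n) (i : Fin (3 * n)) :
    IsTrip w.bumpDiagram i (w.tripPerm i) :=
  (existsUnique_trip w.isTwoColourable).choose_spec.1 i

/-- The map `ε_w`. -/
noncomputable def eps (w : KWord n) (i : Fin (3 * n)) : Letter :=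
  if w.letter (w.tripPerm i) ≠ .A then w.letter (w.tripPerm i)
  else w.letter (w.tripPerm (w.tripPerm i))

end KWord

/-- The reverse-complement `w₀⁻¹ ∘ σ ∘ w₀` of a permutation `σ` of `m` letters, where `w₀` reverses
the order of the letters. -/
def reverseComplement {m : ℕ} (σ : Equiv.Perm (Fin m)) : Equiv.Perm (Fin m) :=
  (Fin.revPerm : Equiv.Perm (Fin m))⁻¹ * σ * Fin.revPerm

/-!
The trips of a bump diagram are compared with promotion, the first one of the sweeps that make up
evacuation.

*Promotion rotates.* Let `m` be the end of the shorter one of the two arcs from the first letter of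
`w`, and `X` its letter. Promotion deletes the first `A`, replaces the `X` at `m` by an `A`, and
appends an `X` (`KWord.promotion_letter`). In the bump diagram the arc from the first place to `m`
is turned over: it becomes an arc from `m` to the new last place. The other arcs of its colour stay
as they are, and so do the arcs of the other colour that do not pass over `m`. Those that do,
say `(c₁, d₁), …, (cᵣ, dᵣ)` from the outermost to the innermost one, with `c₁` the first place,
become `(c₂, d₁), …, (cᵣ, dᵣ₋₁), (m, dᵣ)`. A comparison of the crossings shows that the trips
connect the same places as before, the first place being replaced by the last one. Hence promotion
conjugates `σ_w` by the long cycle (`Promotes.tripPerm_rotate`). The comparison is made for `Walk`,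
which describes a trip by its turns: all the arcs that a trip traverses rightwards have one colour,
and those that it traverses leftwards have the other one.

*Letters of the evacuation.* The `i`-th letter from the end of `evac w` is the letter that is moved
by a partial sweep through a promotion of `w` (`LinExt.evac_seq`). It is still the initial `A` if
the sweep ends before the first return of that promoted word, and the letter at the first return
otherwise. The first return is the value of the trip permutation at the first place, so that
rotating back identifies this letter with `w_{σ_w(i)}` (`KWord.evac_letter_eq`). On the way it turns
out that the trip to `j` begins to the right of `j` exactly if `w_j = A`
(`KWord.letter_tripPerm_eq_A_iff`).

*Trip permutation of the evacuation.* By the last two facts, `σ⁻¹(x)` and `rc(σ_w)(x)`, with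
`σ = σ_{evac w}`, lie on the same side of `x`. Since promotion, `evac` and promotion compose to
`evac`, replacing `w` by its promotion conjugates both permutations by the same power of the long
cycle, so that this remains true after all simultaneous rotations of the three places. The
rotations after which a place lies to the right of `x` determine it, hence `σ⁻¹ = rc(σ_w)`
(`KWord.tripPerm_evac`).

*The letters `ε_w`.* A trip from a closer `i` begins leftwards on an arc of the colour `w_i`, so
that it traverses arcs of the colour `-w_i` rightwards. It follows that `ε_w(i) = -w_i`
(`KWord.eps_of_closer`), and the last assertion is then a consequence of the first two.
-/

/-! ### Words on the natural numbers and their arcs -/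

/-- The contribution of the letter `x` to the excess of `A`'s over `ε`'s. -/
def Letter.weight (ε x : Letter) : ℤ := if x = .A then 1 else if x = ε then -1 else 0

/-- The excess of `A`'s over `ε`'s among the first `k` letters of an infinite word. -/
def excess (f : ℕ → Letter) (ε : Letter) (k : ℕ) : ℤ := ∑ i ∈ Finset.range k, ε.weight (f i)

theorem excess_succ (f : ℕ → Letter) (ε : Letter) (k : ℕ) :
    excess f ε (k + 1) = excess f ε k + ε.weight (f k) := Finset.sum_range_succ _ _

@[simp] theorem Letter.weight_A (ε : Letter) : ε.weight .A = 1 := rfl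

theorem Letter.weight_self {ε : Letter} (h : ε ≠ .A) : ε.weight ε = -1 := by
  simp [Letter.weight, h]

theorem Letter.weight_lower (ε x : Letter) : -1 ≤ ε.weight x := by
  unfold Letter.weight
  split_ifs <;> omega

theorem Letter.weight_upper (ε x : Letter) : ε.weight x ≤ 1 := by
  unfold Letter.weight
  split_ifs <;> omega

theorem Letter.eq_of_weight_neg {ε x : Letter} (h : ε.weight x < 0) : x = ε := by
  unfold Letter.weight at h
  split_ifs at h <;> simp_all

theorem Letter.eq_A_of_weight_pos {ε x : Letter} (h : 0 < ε.weight x) : x = .A := by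
  unfold Letter.weight at h
  split_ifs at h <;> simp_all

theorem Letter.ne_neg_iff {ε : Letter} (hε : ε ≠ .A) (x : Letter) :
    x ≠ -ε ↔ x = .A ∨ x = ε := by
  revert hε
  revert x ε
  decide

theorem Letter.neg_ne_A {ε : Letter} (hε : ε ≠ .A) : -ε ≠ .A := by
  revert hε
  revert ε
  decide

theorem Letter.neg_ne_self {ε : Letter} (hε : ε ≠ .A) : -ε ≠ ε := by
  revert hε
  revert ε
  decide

theorem Letter.neg_neg' (ε : Letter) : - -ε = ε := by
  cases ε <;> rfl

theorem Letter.eq_or_eq_neg {ε x : Letter} (hε : ε ≠ .A) (hx : x ≠ .A) : x = ε ∨ x = -ε := by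
  revert hε hx
  revert ε x
  decide

/-- The pair `(i, j)` is an arc of the noncrossing matching of `A`'s with `ε`'s: the letter `A` at
`i` raises the excess of `A`'s over `ε`'s above a level to which the `ε` at `j` is the first letter
to lower it again. -/
structure IsArc (f : ℕ → Letter) (ε : Letter) (i j : ℕ) : Prop where
  opener : f i = .A
  closer : f j = ε
  lt : i < j
  closes : excess f ε (j + 1) = excess f ε i
  above : ∀ k, i < k → k ≤ j → excess f ε i < excess f ε k

namespace IsArc

variable {f : ℕ → Letter} {ε : Letter}

theorem closer_unique {i j j' : ℕ} (h : IsArc f ε i j) (h' : IsArc f ε i j') : j = j' := by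
  by_contra hne
  have h1 := h.closes
  have h2 := h'.closes
  have h3 := h.lt
  have h4 := h'.lt
  rcases Nat.lt_or_gt_of_ne hne with hlt | hlt
  · have := h'.above (j + 1) (by omega) hlt
    omega
  · have := h.above (j' + 1) (by omega) hlt
    omega

theorem opener_unique {i i' j : ℕ} (h : IsArc f ε i j) (h' : IsArc f ε i' j) : i = i' := by
  by_contra hne
  have h1 := h.closes
  have h2 := h'.closes
  have h3 := h.lt
  have h4 := h'.lt
  rcases Nat.lt_or_gt_of_ne hne with hlt | hlt
  · have := h.above i' hlt h4.le
    omega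
  · have := h'.above i hlt h3.le
    omega

theorem nested {a b c d : ℕ} (h : IsArc f ε a b) (h' : IsArc f ε c d) (hac : a < c)
    (hcb : c < b) : d < b := by
  have h1 := h.closes
  have h2 := h'.closes
  have h3 := h.above c hac hcb.le
  by_contra hle
  rcases Nat.lt_or_eq_of_le (not_lt.mp hle) with hlt | rfl
  · have := h'.above (b + 1) (by omega) hlt
    omega
  · omega

theorem exists_of_opener {i k : ℕ} (hi : f i = .A) (hik : i < k)
    (hk : excess f ε k ≤ excess f ε i) : ∃ j < k, IsArc f ε i j := by
  have hex : ∃ k, i < k ∧ excess f ε k ≤ excess f ε i := ⟨k, hik, hk⟩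
  have h0 : Nat.find hex ≤ k := Nat.find_min' hex ⟨hik, hk⟩
  obtain ⟨h1, h2⟩ := Nat.find_spec hex
  have hmin := fun {m : ℕ} => Nat.find_min hex (m := m)
  generalize Nat.find hex = l at h0 h1 h2 hmin
  obtain ⟨j, rfl⟩ : ∃ j, l = j + 1 := ⟨l - 1, by omega⟩
  have hs := excess_succ f ε i
  rw [hi, Letter.weight_A] at hs
  have hji : i ≠ j := by
    rintro rfl
    omega
  have habove : ∀ m, i < m → m ≤ j → excess f ε i < excess f ε m := fun m hm hmj => by
    by_contra hle
    exact hmin (show m < j + 1 by omega) ⟨hm, not_lt.mp hle⟩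
  have hj := habove j (by omega) le_rfl
  have hsj := excess_succ f ε j
  have hlow := Letter.weight_lower ε (f j)
  exact ⟨j, by omega, hi, Letter.eq_of_weight_neg (by omega), by omega, by omega, habove⟩

theorem exists_of_closer (hε : ε ≠ .A) {j k : ℕ} (hj : f j = ε) (hkj : k ≤ j)
    (hk : excess f ε k ≤ excess f ε (j + 1)) : ∃ i, IsArc f ε i j := by
  have hsj := excess_succ f ε j
  rw [hj, Letter.weight_self hε] at hsj
  have h1 := Nat.findGreatest_le (P := fun k => excess f ε k ≤ excess f ε (j + 1)) j
  have h2 := Nat.findGreatest_spec (P := fun k => excess f ε k ≤ excess f ε (j + 1)) hkj hk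
  have h3 := fun k => Nat.findGreatest_is_greatest
    (P := fun k => excess f ε k ≤ excess f ε (j + 1)) (n := j) (k := k)
  generalize Nat.findGreatest (fun k => excess f ε k ≤ excess f ε (j + 1)) j = i at h1 h2 h3
  have hij : i ≠ j := by
    rintro rfl
    omega
  have h4 : excess f ε (j + 1) < excess f ε (i + 1) :=
    not_le.mp (h3 (i + 1) (by omega) (by omega))
  have hs := excess_succ f ε i
  have hup := Letter.weight_upper ε (f i)
  refine ⟨i, Letter.eq_A_of_weight_pos (ε := ε) (by omega), hj, by omega, by omega, ?_⟩
  intro m hm hmj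
  have := not_le.mp (h3 m hm hmj)
  omega

end IsArc

/-! ### The arcs of the bump diagram of a Kreweras word -/

namespace KWord

variable {n : ℕ}

/-- A Kreweras word, continued by `A`'s. These have no arcs. -/
def extend (w : KWord n) (k : ℕ) : Letter := if h : k < 3 * n then w.letter ⟨k, h⟩ else .A

theorem extend_val (w : KWord n) (i : Fin (3 * n)) : w.extend i = w.letter i := by
  simp [extend]

theorem extend_of_lt (w : KWord n) {k : ℕ} (h : k < 3 * n) : w.extend k = w.letter ⟨k, h⟩ :=
  dif_pos h

theorem lt_of_extend_ne (w : KWord n) {k : ℕ} (h : w.extend k ≠ .A) : k < 3 * n := by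
  by_contra hk
  exact h (dif_neg hk)

theorem excess_extend (w : KWord n) {ε : Letter} (hε : ε ≠ .A) {k : ℕ} (hk : k ≤ 3 * n) :
    excess w.extend ε k = w.height ε k := by
  induction k with
  | zero => simp [excess, height, prefixCount]
  | succ k ih =>
    have h := w.height_succ ε hε ⟨k, hk⟩
    dsimp only at h
    rw [excess_succ, ih (by omega), h, w.extend_of_lt hk]
    rfl

theorem excess_nonneg (w : KWord n) {ε : Letter} (hε : ε ≠ .A) {k : ℕ} (hk : k ≤ 3 * n) :
    0 ≤ excess w.extend ε k := by
  rw [w.excess_extend hε hk]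
  exact w.height_nonneg ε k hk

theorem excess_total (w : KWord n) {ε : Letter} (hε : ε ≠ .A) :
    excess w.extend ε (3 * n) = 0 := by
  rw [w.excess_extend hε le_rfl]
  simp [height, w.total]

theorem exists_arc_of_opener (w : KWord n) {ε : Letter} (hε : ε ≠ .A) {i : ℕ} (hi : i < 3 * n)
    (h : w.extend i = .A) : ∃ j, IsArc w.extend ε i j := by
  obtain ⟨j, -, hj⟩ := IsArc.exists_of_opener h hi
    ((w.excess_total hε).trans_le (w.excess_nonneg hε hi.le))
  exact ⟨j, hj⟩

theorem exists_arc_of_closer (w : KWord n) {ε : Letter} (hε : ε ≠ .A) {j : ℕ}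
    (h : w.extend j = ε) : ∃ i, IsArc w.extend ε i j :=
  IsArc.exists_of_closer hε h (Nat.zero_le j)
    (by simpa [excess] using w.excess_nonneg hε (w.lt_of_extend_ne (h ▸ hε)))

theorem arc_lt (w : KWord n) {ε : Letter} (hε : ε ≠ .A) {i j : ℕ} (h : IsArc w.extend ε i j) :
    j < 3 * n :=
  w.lt_of_extend_ne (h.closer ▸ hε)

open scoped Classical in
/-- The axioms of the matching determine it, and the arcs defined by excesses satisfy them. -/
theorem mem_matching_iff (w : KWord n) {ε : Letter} (hε : ε ≠ .A) (e : Arc (3 * n)) :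
    e ∈ w.matching ε hε ↔ IsArc w.extend ε e.1 e.2 := by
  have hM : w.IsMatching ε
      (Finset.univ.filter fun e : Arc (3 * n) => IsArc w.extend ε e.1 e.2) := by
    have hne := Letter.ne_neg_iff hε
    have hop : ∀ i, w.letter i = .A → ∃ j : Fin (3 * n), IsArc w.extend ε i j := fun i hi => by
      obtain ⟨j, hj⟩ := w.exists_arc_of_opener hε i.isLt (by rw [extend_val, hi])
      exact ⟨⟨j, w.arc_lt hε hj⟩, hj⟩
    have hcl : ∀ j, w.letter j = ε → ∃ i : Fin (3 * n), IsArc w.extend ε i j := fun j hj => by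
      obtain ⟨i, hi⟩ := w.exists_arc_of_closer hε (j := j) (by rw [extend_val, hj])
      exact ⟨⟨i, hi.lt.trans j.isLt⟩, hi⟩
    have hA : ∀ {i j : Fin (3 * n)}, IsArc w.extend ε i j → w.letter i = .A := fun h => by
      rw [← extend_val]; exact h.opener
    have hE : ∀ {i j : Fin (3 * n)}, IsArc w.extend ε i j → w.letter j = ε := fun h => by
      rw [← extend_val]; exact h.closer
    refine ⟨⟨?_, ?_, ?_, ?_⟩, ?_, ?_⟩
    · intro e he
      exact (Finset.mem_filter.mp he).2.lt
    · intro e he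
      have he := (Finset.mem_filter.mp he).2
      exact ⟨(hne _).2 (Or.inl (hA he)), (hne _).2 (Or.inr (hE he))⟩
    · intro i hi
      rcases (hne _).1 hi with hi | hi
      · obtain ⟨j, hj⟩ := hop i hi
        refine ⟨(i, j), ⟨by simpa using hj, Or.inl rfl⟩, ?_⟩
        rintro ⟨a, b⟩ ⟨hf, rfl | rfl⟩
        · exact Prod.ext rfl (Fin.ext ((Finset.mem_filter.mp hf).2.closer_unique hj))
        · exact absurd (hi.symm.trans (hE (Finset.mem_filter.mp hf).2)) hε.symm
      · obtain ⟨j, hj⟩ := hcl i hi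
        refine ⟨(j, i), ⟨by simpa using hj, Or.inr rfl⟩, ?_⟩
        rintro ⟨a, b⟩ ⟨hf, rfl | rfl⟩
        · exact absurd (hi.symm.trans (hA (Finset.mem_filter.mp hf).2)) hε
        · exact Prod.ext (Fin.ext ((Finset.mem_filter.mp hf).2.opener_unique hj)) rfl
    · rintro ⟨a, b⟩ he ⟨c, d⟩ hf ⟨h1, h2, h3⟩
      have he := (Finset.mem_filter.mp he).2
      have hf := (Finset.mem_filter.mp hf).2
      dsimp only at h1 h2 h3 he hf
      rcases Nat.lt_or_eq_of_le (Fin.le_def.mp h1) with h1 | h1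
      · have := he.nested hf h1 h2
        omega
      · rw [← h1] at hf
        have := he.closer_unique hf
        omega
    · ext i
      exact ⟨fun ⟨j, hj⟩ => hA (Finset.mem_filter.mp hj).2,
        fun hi => (hop i hi).imp fun j hj => by simpa using hj⟩
    · ext j
      exact ⟨fun ⟨i, hi⟩ => hE (Finset.mem_filter.mp hi).2,
        fun hj => (hcl j hj).imp fun i hi => by simpa using hi⟩
  rw [(w.existsUnique_matching ε hε).unique (w.isMatching_matching ε hε) hM]
  simp

theorem mem_bumpDiagram_iff (w : KWord n) (e : Arc (3 * n)) :
    e ∈ w.bumpDiagram ↔ IsArc w.extend .B e.1 e.2 ∨ IsArc w.extend .C e.1 e.2 := by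
  rw [bumpDiagram, Finset.mem_union, w.mem_matching_iff, w.mem_matching_iff]

end KWord

/-! ### Walks that record only the turns of a trip -/

/-- The part of a trip that remains, recorded by its turns only. Along the way a trip traverses arcs
of one colour (the relation `R`) rightwards and arcs of the other colour (the relation `L`)
leftwards: it passes straight through a crossing or changes both the colour and the direction.
`Walk R L d a b p j` says that a traveller on the arc `(a, b)`, walking in direction `d` and having
just left the place `p`, will terminate at `j`. -/
inductive Walk (R L : ℕ → ℕ → Prop) : Dir → ℕ → ℕ → ℕ → ℕ → Prop
  | right_end (c d p : ℕ) : R c d → c ≤ p → (∀ a b, L a b → a ≤ c → p < b → ¬ b < d) →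
      Walk R L .right c d p d
  | right_turn (c d p a b j : ℕ) : R c d → c ≤ p → L a b → a < c → p < b → b < d →
      (∀ a' b', L a' b' → a' ≤ c → p < b' → b' < d → b ≤ b') →
      Walk R L .left a b c j → Walk R L .right c d p j
  | left_end (a b q : ℕ) : L a b → a < q → q ≤ b → (∀ c d, R c d → a ≤ c → c < q → ¬ b < d) →
      Walk R L .left a b q a
  | left_turn (a b q c d j : ℕ) : L a b → a < q → q ≤ b → R c d → a ≤ c → c < q → b < d →
      (∀ c' d', R c' d' → a ≤ c' → c' < q → b < d' → c' ≤ c) →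
      Walk R L .right c d b j → Walk R L .left a b q j

theorem Walk.deterministic {R L : ℕ → ℕ → Prop} (hR : ∀ c d d', R c d → R c d' → d = d')
    (hL : ∀ a a' b, L a b → L a' b → a = a') {x : Dir} {a b p j j' : ℕ}
    (h : Walk R L x a b p j) (h' : Walk R L x a b p j') : j = j' := by
  induction h generalizing j' with
  | right_end c d p _ _ hno =>
    cases h' with
    | right_end => rfl
    | right_turn _ _ _ a b _ _ _ hab hac hpb hbd => exact absurd hbd (hno a b hab hac.le hpb)
  | right_turn c d p a b j _ _ hab hac hpb hbd hmin _ ih =>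
    cases h' with
    | right_end _ _ _ _ _ hno => exact absurd hbd (hno a b hab hac.le hpb)
    | right_turn _ _ _ a' b' _ _ _ hab' hac' hpb' hbd' hmin' hw =>
      obtain rfl := le_antisymm (hmin _ _ hab' hac'.le hpb' hbd') (hmin' _ _ hab hac.le hpb hbd)
      obtain rfl := hL _ _ _ hab hab'
      exact ih hw
  | left_end a b q _ _ _ hno =>
    cases h' with
    | left_end => rfl
    | left_turn _ _ _ c d _ _ _ _ hcd hac hcq hbd => exact absurd hbd (hno c d hcd hac hcq)
  | left_turn a b q c d j _ _ _ hcd hac hcq hbd hmax _ ih =>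
    cases h' with
    | left_end _ _ _ _ _ _ hno => exact absurd hbd (hno c d hcd hac hcq)
    | left_turn _ _ _ c' d' _ _ _ _ hcd' hac' hcq' hbd' hmax' hw =>
      obtain rfl := le_antisymm (hmax' _ _ hcd hac hcq hbd) (hmax _ _ hcd' hac' hcq' hbd')
      obtain rfl := hR _ _ _ hcd hcd'
      exact ih hw

/-- A place from which the same turn lies ahead may be moved back. -/
theorem Walk.right_mono {R L : ℕ → ℕ → Prop} {c d p p' j : ℕ} (h : Walk R L .right c d p' j)
    (hcp : c ≤ p) (hpp : p ≤ p') (hno : ∀ a b, L a b → a ≤ c → p < b → b < d → p' < b) :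
    Walk R L .right c d p j := by
  cases h with
  | right_end _ _ _ hcd _ hend =>
    exact .right_end _ _ _ hcd hcp fun a b hab hac hpb hbd =>
      hend a b hab hac (hno a b hab hac hpb hbd) hbd
  | right_turn _ _ _ a b _ hcd _ hab hac hpb hbd hmin hw =>
    exact .right_turn _ _ _ a b _ hcd hcp hab hac (by omega) hbd
      (fun a' b' h1 h2 h3 h4 => hmin a' b' h1 h2 (hno a' b' h1 h2 h3 h4) h4) hw

theorem Walk.left_mono {R L : ℕ → ℕ → Prop} {a b q q' j : ℕ} (h : Walk R L .left a b q' j)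
    (hqb : q ≤ b) (hqq : q' ≤ q) (hno : ∀ c d, R c d → a ≤ c → c < q → b < d → c < q') :
    Walk R L .left a b q j := by
  cases h with
  | left_end _ _ _ hab haq _ hend =>
    exact .left_end _ _ _ hab (by omega) hqb fun c d hcd hac hcq hbd =>
      hend c d hcd hac (hno c d hcd hac hcq hbd) hbd
  | left_turn _ _ _ c d _ hab haq _ hcd hac hcq hbd hmax hw =>
    exact .left_turn _ _ _ c d _ hab (by omega) hqb hcd hac (by omega) hbd
      (fun c' d' h1 h2 h3 h4 => hmax c' d' h1 h2 (hno c' d' h1 h2 h3 h4) h4) hw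

namespace KWord

variable {n : ℕ}

theorem isArc_of_mem (w : KWord n) {e : Arc (3 * n)} (he : e ∈ w.bumpDiagram) :
    w.letter e.2 ≠ .A ∧ IsArc w.extend (w.letter e.2) e.1 e.2 := by
  rcases (w.mem_bumpDiagram_iff e).1 he with h | h <;>
  · have h1 := h.closer
    rw [extend_val] at h1
    rw [h1]
    exact ⟨by decide, h⟩

theorem mem_of_isArc (w : KWord n) {ε : Letter} (hε : ε ≠ .A) {e : Arc (3 * n)}
    (h : IsArc w.extend ε e.1 e.2) : e ∈ w.bumpDiagram := by
  rw [mem_bumpDiagram_iff]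
  cases ε
  · exact absurd rfl hε
  · exact Or.inl h
  · exact Or.inr h

theorem not_crosses_of_letter_eq (w : KWord n) {e f : Arc (3 * n)} (he : e ∈ w.bumpDiagram)
    (hf : f ∈ w.bumpDiagram) (h : w.letter e.2 = w.letter f.2) : ¬ Crosses e f := by
  rintro ⟨h1, h2, h3⟩
  have he := (w.isArc_of_mem he).2
  have hf := (w.isArc_of_mem hf).2
  rw [← h] at hf
  rcases Nat.lt_or_eq_of_le (Fin.le_def.mp h1) with h1 | h1
  · have := he.nested hf h1 h2
    omega
  · rw [← h1] at hf
    have := he.closer_unique hf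
    omega

theorem letter_of_crosses (w : KWord n) {e f : Arc (3 * n)} (he : e ∈ w.bumpDiagram)
    (hf : f ∈ w.bumpDiagram) (h : Crosses e f ∨ Crosses f e) : w.letter f.2 = -w.letter e.2 := by
  refine (Letter.eq_or_eq_neg (w.isArc_of_mem he).1 (w.isArc_of_mem hf).1).resolve_left ?_
  intro hEq
  rcases h with h | h
  · exact w.not_crosses_of_letter_eq he hf hEq.symm h
  · exact w.not_crosses_of_letter_eq hf he hEq h

/-- The colour of the arcs that a traveller traverses rightwards, now or later. -/
def rightColour (w : KWord n) (s : Traveller (3 * n)) : Letter :=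
  match s.dir with
  | .right => w.letter s.arc.2
  | .left => -w.letter s.arc.2

/-- The walks in a word that traverse the arcs of colour `ε` rightwards and those of the other colour
leftwards. -/
abbrev ColourWalk (f : ℕ → Letter) (ε : Letter) : Dir → ℕ → ℕ → ℕ → ℕ → Prop :=
  Walk (IsArc f ε) (IsArc f (-ε))

theorem ColourWalk.deterministic {f : ℕ → Letter} {ε : Letter} {x : Dir} {a b p j j' : ℕ}
    (h : ColourWalk f ε x a b p j) (h' : ColourWalk f ε x a b p j') : j = j' :=
  Walk.deterministic (R := IsArc f ε) (L := IsArc f (-ε)) (fun _ _ _ => IsArc.closer_unique)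
    (fun _ _ _ => IsArc.opener_unique) h h'

open Traveller in
/-- A trip is a walk. The crossings that it passes straight through are absorbed by
`Walk.right_mono` and `Walk.left_mono`. -/
theorem walk_of_reaches (w : KWord n) {s t : Traveller (3 * n)} {j : Fin (3 * n)}
    (hs : s.Valid w.bumpDiagram) (h : Relation.ReflTransGen (VStep w.bumpDiagram) s t)
    (hend : t.IsEnd w.bumpDiagram j) :
    ColourWalk w.extend (w.rightColour s) s.dir s.arc.1 s.arc.2 s.pos j := by
  have hD := w.isTwoColourable
  have mem : ∀ {e : Arc (3 * n)} {a b : ℕ}, e ∈ w.bumpDiagram →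
      IsArc w.extend (-w.letter e.2) a b →
      ∃ g : Arc (3 * n), g ∈ w.bumpDiagram ∧ g.1.val = a ∧ g.2.val = b := by
    intro e a b he hab
    have hne := Letter.neg_ne_A (w.isArc_of_mem he).1
    have hb := w.arc_lt hne hab
    exact ⟨(⟨a, hab.lt.trans hb⟩, ⟨b, hb⟩), w.mem_of_isArc hne hab, rfl, rfl⟩
  have right_bound : ∀ {e : Arc (3 * n)} {p : Fin (3 * n)},
      Valid w.bumpDiagram ⟨e, .right, p⟩ → e.1 ≤ p := by
    intro e p hv
    rcases hv.2 with h | ⟨g, hg, h1, h2⟩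
    · exact h.1.ge
    · exact (show mark e g = p from h2) ▸ (mark_bounds hv.1 hg h1).1
  have left_bound : ∀ {e : Arc (3 * n)} {p : Fin (3 * n)},
      Valid w.bumpDiagram ⟨e, .left, p⟩ → p ≤ e.2 := by
    intro e p hv
    rcases hv.2.2 with h | ⟨g, hg, h1, h2⟩
    · exact h.le
    · exact (show mark e g = p from h2) ▸ (mark_bounds hv.1 hg h1).2.le
  -- the crossings ahead at which a traveller would turn
  have right_ahead : ∀ {e g : Arc (3 * n)} {p : Fin (3 * n)}, e.1 ≤ p → g ∈ w.bumpDiagram →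
      g.1 ≤ e.1 → p < g.2 → g.2 < e.2 →
      CrossingAhead w.bumpDiagram ⟨e, .right, p⟩ g ∧ mark e g = g.2 := by
    intro e g p hp hg h1 h2 h3
    have hc : Crosses g e := ⟨h1, lt_of_le_of_lt hp h2, h3⟩
    refine ⟨⟨hg, Or.inr hc, ?_⟩, mark_of_crosses' hc⟩
    show p < mark e g
    rwa [mark_of_crosses' hc]
  have left_ahead : ∀ {e g : Arc (3 * n)} {p : Fin (3 * n)}, p ≤ e.2 → g ∈ w.bumpDiagram →
      e.1 ≤ g.1 → g.1 < p → e.2 < g.2 →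
      CrossingAhead w.bumpDiagram ⟨e, .left, p⟩ g ∧ mark e g = g.1 := by
    intro e g p hp hg h1 h2 h3
    have hc : Crosses e g := ⟨h1, lt_of_lt_of_le h2 hp, h3⟩
    refine ⟨⟨hg, Or.inl hc, ?_⟩, mark_of_crosses hc⟩
    show mark e g < p
    rwa [mark_of_crosses hc]
  induction h using Relation.ReflTransGen.head_induction_on with
  | refl =>
    obtain ⟨⟨a, b⟩, d, p⟩ := t
    obtain ⟨rfl, hno⟩ := hend
    have harc := (w.isArc_of_mem hs.1).2
    cases d with
    | right =>
      refine Walk.right_end _ _ _ harc (right_bound hs) fun x y hxy h1 h2 h3 => ?_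
      obtain ⟨g, hg, rfl, rfl⟩ := mem hs.1 hxy
      exact hno g (right_ahead (right_bound hs) hg h1 h2 h3).1
    | left =>
      have harc' : IsArc w.extend (- -w.letter b) a b := by rwa [Letter.neg_neg']
      refine Walk.left_end _ _ _ harc' hs.2.1 (left_bound hs) fun x y hxy h1 h2 h3 => ?_
      obtain ⟨g, hg, rfl, rfl⟩ := mem hs.1 hxy
      exact hno g (left_ahead (left_bound hs) hg h1 h2 h3).1
  | head hstep _ ih =>
    rename_i s u
    have huv := hstep.2.valid hD hs
    have ih := ih huv
    obtain ⟨-, hstep⟩ := hstep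
    cases hstep with
    | from_a ab cd p hc hn =>
      have ih : ColourWalk w.extend (w.letter ab.2) .right ab.1 ab.2 (mark ab cd) j := ih
      refine Walk.right_mono ih (right_bound hs) (Fin.le_def.mp (le_of_lt hn.1.2.2)) ?_
      intro x y hxy h1 h2 h3
      obtain ⟨g, hg, rfl, rfl⟩ := mem hs.1 hxy
      have hg' := right_ahead (right_bound hs) hg h1 h2 h3
      have h4 : mark ab cd ≤ mark ab g := hn.2 g hg'.1
      rw [hg'.2] at h4
      refine lt_of_le_of_ne h4 fun hEq => ?_
      rw [mark_of_crosses hc] at hEq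
      exact hD.ne _ hn.1.1 _ hg (Fin.ext hEq)
    | from_c ab cd p hc hn =>
      have hab := hn.1.1
      have hcol : w.letter ab.2 = -w.letter cd.2 :=
        w.letter_of_crosses hs.1 hab (Or.inr hc)
      have ih : ColourWalk w.extend (-w.letter ab.2) .left ab.1 ab.2 (mark ab cd) j := ih
      rw [hcol, Letter.neg_neg', mark_of_crosses hc] at ih
      have hp : p < ab.2 := by
        have : p < mark cd ab := hn.1.2.2
        rwa [mark_of_crosses' hc] at this
      have h1 : ab.1 < cd.1 := by
        have : ab.1 < mark ab cd := huv.2.1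
        rwa [mark_of_crosses hc] at this
      refine Walk.right_turn _ _ _ ab.1 ab.2 _ (w.isArc_of_mem hs.1).2 (right_bound hs)
        (hcol ▸ (w.isArc_of_mem hab).2) h1 hp hc.2.2 ?_ ih
      intro x y hxy h1 h2 h3
      obtain ⟨g, hg, rfl, rfl⟩ := mem hs.1 hxy
      have hg' := right_ahead (right_bound hs) hg h1 h2 h3
      have h4 : mark cd ab ≤ mark cd g := hn.2 g hg'.1
      rwa [hg'.2, mark_of_crosses' hc] at h4
    | from_b ab cd p hc hn =>
      have hcd := hn.1.1
      have hcol : w.letter cd.2 = -w.letter ab.2 :=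
        w.letter_of_crosses hs.1 hcd (Or.inl hc)
      have ih : ColourWalk w.extend (w.letter cd.2) .right cd.1 cd.2 (mark cd ab) j := ih
      rw [hcol, mark_of_crosses' hc] at ih
      have hp : cd.1 < p := by
        have : mark ab cd < p := hn.1.2.2
        rwa [mark_of_crosses hc] at this
      have harc' : IsArc w.extend (- -w.letter ab.2) ab.1 ab.2 := by
        rw [Letter.neg_neg']
        exact (w.isArc_of_mem hs.1).2
      refine Walk.left_turn _ _ _ cd.1 cd.2 _ harc' hs.2.1 (left_bound hs)
        (show IsArc w.extend (-w.letter ab.2) _ _ from hcol ▸ (w.isArc_of_mem hcd).2)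
        hc.1 hp hc.2.2 ?_ ih
      intro x y hxy h1 h2 h3
      obtain ⟨g, hg, rfl, rfl⟩ := mem hs.1 hxy
      have hg' := left_ahead (left_bound hs) hg h1 h2 h3
      have h4 : mark ab g ≤ mark ab cd := hn.2 g hg'.1
      rwa [hg'.2, mark_of_crosses hc] at h4
    | from_d ab cd p hc hn =>
      have ih : ColourWalk w.extend (-w.letter cd.2) .left cd.1 cd.2 (mark cd ab) j := ih
      refine Walk.left_mono ih (left_bound hs) (Fin.le_def.mp (le_of_lt hn.1.2.2)) ?_
      intro x y hxy h1 h2 h3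
      obtain ⟨g, hg, rfl, rfl⟩ := mem hs.1 hxy
      have hg' := left_ahead (left_bound hs) hg h1 h2 h3
      have h4 : mark cd g ≤ mark cd ab := hn.2 g hg'.1
      rw [hg'.2] at h4
      refine lt_of_le_of_ne h4 fun hEq => ?_
      rw [mark_of_crosses' hc] at hEq
      exact hD.ne _ hg _ hn.1.1 (Fin.ext hEq)

open Traveller in
theorem walk_of_isStart (w : KWord n) {i : Fin (3 * n)} {s : Traveller (3 * n)}
    (h : IsStart w.bumpDiagram i s) :
    ColourWalk w.extend (w.rightColour s) s.dir s.arc.1 s.arc.2 s.pos (w.tripPerm i) := by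
  have hD := w.isTwoColourable
  obtain ⟨s', t, hs, hst, ht⟩ := w.isTrip_tripPerm i
  obtain rfl := start_unique hD h hs
  exact w.walk_of_reaches (hs.valid hD) (reaches_valid hD (hs.valid hD) hst).1 ht

/-- A trip from a closer begins along its arc. -/
theorem walk_of_closer (w : KWord n) {ε : Letter} (hε : ε ≠ .A) {a : ℕ} {i : Fin (3 * n)}
    (h : IsArc w.extend (-ε) a i) : ColourWalk w.extend ε .left a i i (w.tripPerm i) := by
  have h0 : w.letter i = -ε := by rw [← extend_val]; exact h.closer
  have := w.walk_of_isStart (.closer ⟨a, h.lt.trans i.isLt⟩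
    (w.mem_of_isArc (Letter.neg_ne_A hε) (e := (⟨a, h.lt.trans i.isLt⟩, i)) h))
  simpa [rightColour, h0, Letter.neg_neg'] using this

/-- A trip from an opener ends at the nearer one of the two closers: the arc to it only meets arcs
that it passes straight through. -/
theorem tripPerm_of_opener (w : KWord n) {ε : Letter} (hε : ε ≠ .A) {i : Fin (3 * n)} {d x : ℕ}
    (h : IsArc w.extend ε i d) (hx : IsArc w.extend (-ε) i x) (hdx : d < x) :
    (w.tripPerm i : ℕ) = d := by
  have hd := w.arc_lt hε h
  have h0 : w.letter ⟨d, hd⟩ = ε := by rw [← w.extend_of_lt hd]; exact h.closer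
  have hstart := w.walk_of_isStart (i := i) (.opener ⟨d, hd⟩
    (w.mem_of_isArc hε (e := (i, ⟨d, hd⟩)) h) fun k hk => by
      have hk := w.isArc_of_mem hk
      rcases Letter.eq_or_eq_neg hε hk.1 with h1 | h1 <;> rw [h1] at hk
      · exact (h.closer_unique hk.2).le
      · exact Fin.le_def.mpr (hdx.le.trans (hx.closer_unique hk.2).le))
  simp only [rightColour, h0] at hstart
  refine ColourWalk.deterministic hstart (Walk.right_end _ _ _ h le_rfl ?_)
  intro a b hab hai hib hbd
  rcases Nat.lt_or_eq_of_le hai with hlt | rfl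
  · have := hab.nested hx hlt hib
    omega
  · have := hab.closer_unique hx
    omega

/-- A walk ends at a closer of a rightward arc, or at an opener whose leftward arc is the longer one
of its two arcs. -/
theorem ColourWalk.terminal {f : ℕ → Letter} {ε : Letter} {x : Dir} {a b p j : ℕ}
    (h : ColourWalk f ε x a b p j) :
    f j = ε ∨ f j = .A ∧ ∃ b, IsArc f (-ε) j b ∧ ∀ d, IsArc f ε j d → d ≤ b := by
  induction h with
  | right_end _ _ _ h => exact Or.inl h.closer
  | right_turn _ _ _ _ _ _ _ _ _ _ _ _ _ _ ih => exact ih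
  | left_end a b q h haq _ hno =>
    exact Or.inr ⟨h.opener, b, h, fun d hd => not_lt.mp (hno a d hd le_rfl haq)⟩
  | left_turn _ _ _ _ _ _ _ _ _ _ _ _ _ _ _ ih => exact ih

/-! ### The letters `ε_w` -/

theorem eps_of_closer (w : KWord n) {i : Fin (3 * n)} (hi : w.letter i ≠ .A) :
    w.eps i = -w.letter i := by
  have hε := Letter.neg_ne_A hi
  have h0 : w.extend i = - -w.letter i := by rw [Letter.neg_neg', extend_val]
  obtain ⟨a, ha⟩ := w.exists_arc_of_closer (Letter.neg_ne_A hε) h0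
  generalize -w.letter i = ε at hε ha
  unfold eps
  rcases (w.walk_of_closer hε ha).terminal with h | ⟨h, b, hb, hmax⟩
  · rw [extend_val] at h
    rwa [if_pos (h ▸ hε)]
  · -- the trip from that opener follows its shorter arc, which has the colour `ε`
    obtain ⟨d, hd⟩ := w.exists_arc_of_opener hε (w.tripPerm i).isLt h
    rw [extend_val] at h
    have hdb : d ≠ b := by
      rintro rfl
      exact Letter.neg_ne_self hε (hb.closer.symm.trans hd.closer)
    have h1 := w.tripPerm_of_opener hε hd hb (lt_of_le_of_ne (hmax d hd) hdb)
    rw [if_neg (not_not.mpr h), ← extend_val, h1]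
    exact hd.closer

theorem letter_tripPerm_of_opener (w : KWord n) {i : Fin (3 * n)} (hi : w.letter i = .A) :
    w.letter (w.tripPerm i) ≠ .A := by
  rw [← extend_val] at hi
  obtain ⟨b, hb⟩ := w.exists_arc_of_opener (ε := .B) (by decide) i.isLt hi
  obtain ⟨c, hc⟩ := w.exists_arc_of_opener (ε := .C) (by decide) i.isLt hi
  rw [← extend_val]
  rcases lt_trichotomy b c with h | rfl | h
  · rw [w.tripPerm_of_opener (ε := .B) (by decide) hb hc h, hb.closer]
    decide
  · exact absurd (hb.closer.symm.trans hc.closer) (by decide)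
  · rw [w.tripPerm_of_opener (ε := .C) (by decide) hc hb h, hc.closer]
    decide

end KWord

/-! ### How promotion changes the arcs -/

/-- The word `f'` arises from `f`, whose first `ℓ` letters form a Kreweras word, by promotion; but
its letters occupy the places `1, …, ℓ` instead of `0, …, ℓ - 1`. The first letter `A` of `f` is
matched with the letter `X` at `m` by its shorter arc. That `X` becomes an `A`, and a letter `X` is
added at the place `ℓ`. The letter `f' 0 = X`, which does not belong to the promoted word, has no
arc; with this choice the excesses of `f` and `f'` agree beyond `m`. -/
structure Promotes (f f' : ℕ → Letter) (X : Letter) (m ℓ : ℕ) : Prop where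
  ne_A : X ≠ .A
  first : IsArc f X 0 m
  lt : m < ℓ
  nonneg : ∀ ε ≠ .A, ∀ k ≤ ℓ, 0 ≤ excess f ε k
  total : ∀ ε ≠ .A, excess f ε ℓ = 0
  pos : ∀ k, 0 < k → k ≤ m + 1 → 0 < excess f (-X) k
  tail : ∀ k, ℓ ≤ k → f k = .A
  zero' : f' 0 = X
  turn' : f' m = .A
  last' : f' ℓ = X
  else' : ∀ k, k ≠ 0 → k ≠ m → k ≠ ℓ → f' k = f k

namespace Promotes

variable {f f' : ℕ → Letter} {X : Letter} {m ℓ : ℕ}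

theorem m_pos (P : Promotes f f' X m ℓ) : 0 < m := P.first.lt

theorem f_m (P : Promotes f f' X m ℓ) : f m = X := P.first.closer

theorem f_zero (P : Promotes f f' X m ℓ) : f 0 = .A := P.first.opener

theorem excess_zero (f : ℕ → Letter) (ε : Letter) : excess f ε 0 = 0 := rfl

theorem excess_low (P : Promotes f f' X m ℓ) (ε : Letter) {k : ℕ} (h1 : 1 ≤ k) (h2 : k ≤ m) :
    excess f' ε k = excess f ε k - 1 + ε.weight X := by
  induction k, h1 using Nat.le_induction with
  | base =>
    rw [excess_succ, excess_succ, P.zero', P.f_zero, Letter.weight_A, excess_zero, excess_zero]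
    omega
  | succ k h ih =>
    have := P.lt
    rw [excess_succ, excess_succ, P.else' k (by omega) (by omega) (by omega), ih (by omega)]
    omega

theorem excess_high (P : Promotes f f' X m ℓ) (ε : Letter) {k : ℕ} (h1 : m < k) (h2 : k ≤ ℓ) :
    excess f' ε k = excess f ε k := by
  have h1 : m + 1 ≤ k := h1
  induction k, h1 using Nat.le_induction with
  | base =>
    rw [excess_succ, excess_succ, P.turn', P.f_m, P.excess_low ε P.m_pos le_rfl, Letter.weight_A]
    omega
  | succ k h ih =>
    have := P.lt
    rw [excess_succ, excess_succ, P.else' k (by omega) (by omega) (by omega),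
      ih (by omega) (by omega)]

theorem neg_ne_A (P : Promotes f f' X m ℓ) : -X ≠ .A := Letter.neg_ne_A P.ne_A

theorem excess_low_self (P : Promotes f f' X m ℓ) {k : ℕ} (h1 : 1 ≤ k) (h2 : k ≤ m) :
    excess f' X k = excess f X k - 2 := by
  rw [P.excess_low X h1 h2, Letter.weight_self P.ne_A]
  omega

theorem excess_low_neg (P : Promotes f f' X m ℓ) {k : ℕ} (h1 : 1 ≤ k) (h2 : k ≤ m) :
    excess f' (-X) k = excess f (-X) k - 1 := by
  have h : (-X).weight X = 0 := by
    have := P.ne_A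
    have := (Letter.neg_ne_self P.ne_A).symm
    simp [Letter.weight, *]
  rw [P.excess_low (-X) h1 h2, h]
  omega

theorem excess_m (P : Promotes f f' X m ℓ) : excess f X m = 1 := by
  have h1 := excess_succ f X m
  rw [P.first.closes, excess_zero, P.f_m, Letter.weight_self P.ne_A] at h1
  omega

theorem excess_m_succ (P : Promotes f f' X m ℓ) : excess f X (m + 1) = 0 := P.first.closes

theorem arc_lt (P : Promotes f f' X m ℓ) {ε : Letter} (hε : ε ≠ .A) {a b : ℕ}
    (h : IsArc f ε a b) : b < ℓ := by
  by_contra hb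
  exact hε (h.closer.symm.trans (P.tail b (not_lt.mp hb)))

theorem exists_opener (P : Promotes f f' X m ℓ) {ε : Letter} (hε : ε ≠ .A) {b : ℕ}
    (h : f b = ε) : ∃ a, IsArc f ε a b := by
  have hb : b < ℓ := by
    by_contra hb
    exact hε (h.symm.trans (P.tail b (not_lt.mp hb)))
  exact IsArc.exists_of_closer hε h (Nat.zero_le b) (P.nonneg ε hε (b + 1) hb)

theorem exists_closer (P : Promotes f f' X m ℓ) {ε : Letter} (hε : ε ≠ .A) {a : ℕ}
    (ha : a < ℓ) (h : f a = .A) : ∃ b, IsArc f ε a b := by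
  obtain ⟨b, -, hb⟩ := IsArc.exists_of_opener h ha
    ((P.total ε hε).trans_le (P.nonneg ε hε a ha.le))
  exact ⟨b, hb⟩

/-! #### Arcs of the colour of the shorter first arc -/

/-- No arc of this colour passes over `m`. -/
theorem self_split (P : Promotes f f' X m ℓ) {a b : ℕ} (h : IsArc f X a b) (hb : b ≠ m) :
    0 < a ∧ b < m ∨ m < a := by
  have ha : a ≠ 0 := by
    rintro rfl
    exact hb (h.closer_unique P.first)
  have ha' : a ≠ m := by
    rintro rfl
    exact P.ne_A (P.f_m.symm.trans h.opener)
  by_contra hcon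
  have h1 := h.above (m + 1) (by omega) (by omega)
  rw [P.excess_m_succ] at h1
  have := P.nonneg X P.ne_A a (by have := P.lt; omega)
  omega

theorem self_arc (P : Promotes f f' X m ℓ) {a b : ℕ} (h : IsArc f X a b) (hb : b ≠ m) :
    IsArc f' X a b := by
  have hbl := P.arc_lt P.ne_A h
  have hab := h.lt
  have hml := P.lt
  have hs := P.self_split h hb
  refine ⟨?_, ?_, hab, ?_, ?_⟩
  · rw [P.else' a (by omega) (by omega) (by omega), h.opener]
  · rw [P.else' b (by omega) (by omega) (by omega), h.closer]
  · have := h.closes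
    rcases hs with hs | hs
    · rw [P.excess_low_self (by omega) (by omega), P.excess_low_self (by omega) (by omega), this]
    · rw [P.excess_high X (by omega) (by omega), P.excess_high X (by omega) (by omega), this]
  · intro k hk hkb
    have := h.above k hk hkb
    rcases hs with hs | hs
    · rw [P.excess_low_self (by omega) (by omega), P.excess_low_self (by omega) (by omega)]
      omega
    · rwa [P.excess_high X (by omega) (by omega), P.excess_high X (by omega) (by omega)]

/-- The shorter one of the two arcs from the first letter is turned over. -/
theorem last_arc (P : Promotes f f' X m ℓ) : IsArc f' X m ℓ := by
  have hml := P.lt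
  have h0 := P.m_pos
  have h1 : excess f' X m = -1 := by
    rw [P.excess_low_self h0 le_rfl, P.excess_m]
    rfl
  refine ⟨P.turn', P.last', hml, ?_, ?_⟩
  · rw [excess_succ, P.excess_high X hml le_rfl, P.total X P.ne_A, P.last',
      Letter.weight_self P.ne_A, h1]
    rfl
  · intro k hk hkl
    rw [h1, P.excess_high X hk hkl]
    have := P.nonneg X P.ne_A k hkl
    omega

theorem self_arc_cases (P : Promotes f f' X m ℓ) {a b : ℕ} (h : IsArc f' X a b) :
    a = m ∧ b = ℓ ∨ b ≠ m ∧ IsArc f X a b := by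
  have hab := h.lt
  have hml := P.lt
  have hbl : b ≤ ℓ := by
    by_contra hb
    exact P.ne_A (h.closer.symm.trans
      ((P.else' b (by omega) (by omega) (by omega)).trans (P.tail b (by omega))))
  rcases Nat.lt_or_eq_of_le hbl with hlt | rfl
  · have hbm : b ≠ m := by
      rintro rfl
      exact P.ne_A (h.closer.symm.trans P.turn')
    have hfb : f b = X := by rw [← P.else' b (by omega) hbm (by omega), h.closer]
    obtain ⟨a', ha'⟩ := P.exists_opener P.ne_A hfb
    rw [h.opener_unique (P.self_arc ha' hbm)]
    exact Or.inr ⟨hbm, ha'⟩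
  · exact Or.inl ⟨h.opener_unique P.last_arc, rfl⟩

/-! #### Arcs of the other colour -/

theorem neg_closer_ne (P : Promotes f f' X m ℓ) {a b : ℕ} (h : IsArc f (-X) a b) : b ≠ m := by
  rintro rfl
  exact Letter.neg_ne_self P.ne_A (h.closer.symm.trans P.f_m)

theorem neg_opener_ne (P : Promotes f f' X m ℓ) {a b : ℕ} (h : IsArc f (-X) a b) : a ≠ m := by
  rintro rfl
  exact P.ne_A (P.f_m.symm.trans h.opener)

theorem neg_closer_iff (P : Promotes f f' X m ℓ) {b : ℕ} : f' b = -X ↔ f b = -X := by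
  have h1 := (Letter.neg_ne_self P.ne_A).symm
  have h2 := P.neg_ne_A.symm
  by_cases h : b ≠ 0 ∧ b ≠ m ∧ b ≠ ℓ
  · rw [P.else' b h.1 h.2.1 h.2.2]
  · obtain rfl | rfl | rfl : b = 0 ∨ b = m ∨ b = ℓ := by omega
    · simp [P.zero', P.f_zero, h1, h2]
    · simp [P.turn', P.f_m, h1, h2]
    · simp [P.last', P.tail, h1, h2]

/-- An arc of the other colour that does not pass over `m` is not changed. -/
theorem neg_arc (P : Promotes f f' X m ℓ) {a b : ℕ} (h : IsArc f (-X) a b)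
    (hs : b < m ∨ m < a) : IsArc f' (-X) a b := by
  have hbl := P.arc_lt P.neg_ne_A h
  have hab := h.lt
  have hml := P.lt
  have ha : a ≠ 0 := by
    rintro rfl
    have := P.pos (b + 1) (by omega) (by omega)
    rw [h.closes, excess_zero] at this
    omega
  refine ⟨?_, P.neg_closer_iff.2 h.closer, hab, ?_, ?_⟩
  · rw [P.else' a (by omega) (by omega) (by omega), h.opener]
  · have := h.closes
    rcases hs with hs | hs
    · rw [P.excess_low_neg (by omega) (by omega), P.excess_low_neg (by omega) (by omega), this]
    · rw [P.excess_high _ (by omega) (by omega), P.excess_high _ (by omega) (by omega), this]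
  · intro k hk hkb
    have := h.above k hk hkb
    rcases hs with hs | hs
    · rw [P.excess_low_neg (by omega) (by omega), P.excess_low_neg (by omega) (by omega)]
      omega
    · rwa [P.excess_high _ (by omega) (by omega), P.excess_high _ (by omega) (by omega)]

/-- The two arcs that end at the same closer of the other colour are equal unless both begin at or
before `m` and end after it. -/
theorem neg_same_closer (P : Promotes f f' X m ℓ) {a a' b : ℕ} (h : IsArc f (-X) a b)
    (h' : IsArc f' (-X) a' b) : a' = a ∧ 0 < a ∧ (b < m ∨ m < a) ∨ a < m ∧ a' ≤ m ∧ m < b := by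
  by_cases hs : b < m ∨ m < a
  · have := h'.opener_unique (P.neg_arc h hs)
    refine Or.inl ⟨this, ?_, hs⟩
    rcases Nat.eq_zero_or_pos a with rfl | h0
    · rw [this] at h'
      exact absurd (h'.opener.symm.trans P.zero').symm P.ne_A
    · exact h0
  · have h1 := P.neg_closer_ne h
    have h2 := P.neg_opener_ne h
    refine Or.inr ⟨by omega, ?_, by omega⟩
    by_contra ha'
    have h3 := h'.closes
    have h4 := h'.lt
    have hbl := P.arc_lt P.neg_ne_A h
    rw [P.excess_high _ (by omega) (by omega), P.excess_high _ (by omega) (by omega),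
      h.closes] at h3
    have := h.above a' (by omega) h4.le
    omega

theorem neg_exists_old (P : Promotes f f' X m ℓ) {a' b : ℕ} (h' : IsArc f' (-X) a' b) :
    ∃ a, IsArc f (-X) a b :=
  P.exists_opener P.neg_ne_A (P.neg_closer_iff.1 h'.closer)

theorem neg_exists_new (P : Promotes f f' X m ℓ) {a b : ℕ} (h : IsArc f (-X) a b) :
    ∃ a', IsArc f' (-X) a' b := by
  have hbl := P.arc_lt P.neg_ne_A h
  by_cases hs : b < m ∨ m < a
  · exact ⟨a, P.neg_arc h hs⟩
  · have h1 := P.neg_closer_ne h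
    refine IsArc.exists_of_closer (k := 1) P.neg_ne_A (P.neg_closer_iff.2 h.closer) (by omega) ?_
    have h0 := P.m_pos
    rw [P.excess_low_neg le_rfl h0, P.excess_high _ (by omega) (by omega), excess_succ,
      excess_zero, P.f_zero, Letter.weight_A]
    have := P.nonneg _ P.neg_ne_A (b + 1) hbl
    omega

theorem neg_arc_lt (P : Promotes f f' X m ℓ) {a' b : ℕ} (h' : IsArc f' (-X) a' b) : b < ℓ := by
  obtain ⟨a, ha⟩ := P.neg_exists_old h'
  exact P.arc_lt P.neg_ne_A ha

/-- After the end of the longer arc from the first letter, no new arc passes over `m`. -/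
theorem neg_first (P : Promotes f f' X m ℓ) {b : ℕ} (h : IsArc f (-X) 0 b) {x y : ℕ}
    (hxy : IsArc f' (-X) x y) (hx : x ≤ m) : y ≤ b := by
  by_contra hby
  have hmb : m < b := by
    by_contra hmb
    have := P.pos (b + 1) (by omega) (by have := P.neg_closer_ne h; omega)
    rw [h.closes, excess_zero] at this
    omega
  have hyl := P.neg_arc_lt hxy
  have h1 := hxy.above (b + 1) (by omega) (by omega)
  have hx0 : 1 ≤ x := by
    rcases Nat.eq_zero_or_pos x with rfl | h0
    · exact absurd (hxy.opener.symm.trans P.zero').symm P.ne_A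
    · exact h0
  rw [P.excess_low_neg hx0 hx, P.excess_high _ (by omega) (by omega), h.closes,
    excess_zero] at h1
  have := P.pos x hx0 (by omega)
  omega

/-- An opener whose arc passes over `m` has a longer arc afterwards. -/
theorem neg_longer (P : Promotes f f' X m ℓ) {a b : ℕ} (h : IsArc f (-X) a b) (ha : a < m)
    (hb : m < b) (h0 : 0 < a) : ∃ b', IsArc f' (-X) a b' ∧ b < b' := by
  have hml := P.lt
  have hbl := P.arc_lt P.neg_ne_A h
  have e0 := P.excess_low_neg h0 ha.le
  have e1 := P.nonneg _ P.neg_ne_A a (by omega)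
  have e2 : 0 < excess f (-X) a := P.pos a h0 (by omega)
  obtain ⟨b', -, hb'⟩ := IsArc.exists_of_opener (f := f') (ε := -X) (i := a) (k := ℓ)
    (by rw [P.else' a (by omega) (by omega) (by omega), h.opener]) (by omega)
    (by rw [P.excess_high _ hml le_rfl, P.total _ P.neg_ne_A]; omega)
  refine ⟨b', hb', ?_⟩
  by_contra hle
  have h1 := hb'.closes
  have h2 := hb'.lt
  have h3 : excess f (-X) a ≤ excess f (-X) (b' + 1) := by
    rcases Nat.lt_or_eq_of_le (not_lt.mp hle) with hlt | rfl
    · exact (h.above (b' + 1) (by omega) hlt).le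
    · exact h.closes.ge
  rcases Nat.lt_or_ge m (b' + 1) with h4 | h4
  · rw [P.excess_high _ h4 (by omega)] at h1
    omega
  · rw [P.excess_low_neg (by omega) h4] at h1
    have := h.above (b' + 1) (by omega) (by omega)
    omega

/-- The new closer of an opener whose arc passes over `m` is the next closer of such an arc. -/
theorem neg_next (P : Promotes f f' X m ℓ) {a b b' : ℕ} (h : IsArc f (-X) a b) (ha : a < m)
    (hb : m < b) (h' : IsArc f' (-X) a b') {x y : ℕ} (hxy : IsArc f' (-X) x y) (hx : x ≤ m)
    (hy : b < y) : b' ≤ y := by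
  have h0 : 0 < a := by
    rcases Nat.eq_zero_or_pos a with rfl | h0
    · exact absurd (h'.opener.symm.trans P.zero').symm P.ne_A
    · exact h0
  by_contra hlt
  have hyl := P.neg_arc_lt hxy
  obtain ⟨x0, hx0⟩ := P.neg_exists_old hxy
  have hx0m : x0 < m := by
    rcases P.neg_same_closer hx0 hxy with h | h <;> omega
  have hx0a : x0 < a := by
    rcases lt_trichotomy x0 a with h1 | rfl | h1
    · exact h1
    · have := h.closer_unique hx0
      omega
    · have := h.nested hx0 h1 (by omega)
      omega
  have h1 := hx0.above a hx0a (by omega)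
  have h2 := h'.above (y + 1) (by omega) (by omega)
  rw [P.excess_low_neg h0 ha.le, P.excess_high _ (by omega) (by omega), hx0.closes] at h2
  omega

end Promotes

/-! ### How promotion changes the trips -/

namespace Promotes

variable {f f' : ℕ → Letter} {X : Letter} {m ℓ : ℕ}

/-- The place of the promoted word that corresponds to the place `j` of the original one. -/
def wrap (ℓ j : ℕ) : ℕ := if j = 0 then ℓ else j

theorem wrap_zero (ℓ : ℕ) : wrap ℓ 0 = ℓ := rfl

theorem wrap_pos (ℓ : ℕ) {j : ℕ} (h : 0 < j) : wrap ℓ j = j := if_neg h.ne'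

/-- Walks traversing the arcs of colour `X` rightwards. They enter an arc `(a, b)` that passes over
`m` only beyond `m`, and unless they turn off before reaching `m`, they terminate at `a`. In the
promoted word they turn into the new arc `(m, ℓ)` instead and, unless they terminate at `ℓ`, leave it
on the arc which now begins at `a`. -/
theorem walk_self (P : Promotes f f' X m ℓ) {x : Dir} {a b p j : ℕ}
    (h : Walk (IsArc f X) (IsArc f (-X)) x a b p j) :
    match x with
    | .right => b ≠ m → Walk (IsArc f' X) (IsArc f' (-X)) .right a b p (wrap ℓ j)
    | .left => ∀ a', IsArc f' (-X) a' b → (a ≤ m → b < m ∨ m < p) →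
        Walk (IsArc f' X) (IsArc f' (-X)) .left a' b p (wrap ℓ j) := by
  have hml := P.lt
  -- the arcs turned to from an arc of colour `X`
  have compare : ∀ {c d a a' b : ℕ}, IsArc f X c d → d ≠ m → IsArc f (-X) a b →
      IsArc f' (-X) a' b → c < b → b < d → (a ≤ c ↔ a' ≤ c) ∧ (a < c ↔ a' < c) := by
    intro c d a a' b hcd hd h h' hcb hbd
    have h1 := P.self_split hcd hd
    have h2 := h.lt
    have h3 := h'.lt
    rcases P.neg_same_closer h h' with h4 | h4 <;> omega
  induction h with
  | right_end c d p hcd hcp hno =>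
    intro hd
    have hd0 := hcd.lt
    rw [wrap_pos ℓ (by omega)]
    refine .right_end _ _ _ (P.self_arc hcd hd) hcp fun a' b h' ha hpb hbd => ?_
    obtain ⟨a, ha'⟩ := P.neg_exists_old h'
    exact hno a b ha' ((compare hcd hd ha' h' (by omega) hbd).1.2 ha) hpb hbd
  | right_turn c d p a b j hcd hcp hab hac hpb hbd hmin _ ih =>
    intro hd
    obtain ⟨a', ha'⟩ := P.neg_exists_new hab
    refine .right_turn _ _ _ a' b _ (P.self_arc hcd hd) hcp ha'
      ((compare hcd hd hab ha' (by omega) hbd).2.1 hac) hpb hbd ?_ (ih a' ha' ?_)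
    · intro x y hxy h1 h2 h3
      obtain ⟨x0, hx0⟩ := P.neg_exists_old hxy
      exact hmin x0 y hx0 ((compare hcd hd hx0 hxy (by omega) h3).1.2 h1) h2 h3
    · have := P.self_split hcd hd
      omega
  | left_end a b q hab haq hqb hno =>
    intro a' ha' hq
    have hbl := P.neg_arc_lt ha'
    rcases P.neg_same_closer hab ha' with ⟨rfl, h0, hs⟩ | ⟨h1, h2, h3⟩
    · rw [wrap_pos ℓ h0]
      refine .left_end _ _ _ ha' haq hqb fun c d hcd h1 h2 h3 => ?_
      rcases P.self_arc_cases hcd with ⟨rfl, rfl⟩ | ⟨-, hcd⟩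
      · omega
      · exact hno c d hcd h1 h2 h3
    · have hqm : m < q := by
        have := hq h1.le
        omega
      refine .left_turn _ _ _ m ℓ _ ha' (by omega) hqb P.last_arc h2 hqm hbl ?_ ?_
      · intro c d hcd h4 h5 h6
        rcases P.self_arc_cases hcd with ⟨rfl, rfl⟩ | ⟨hd, hcd⟩
        · exact le_rfl
        · refine absurd h6 (hno c d hcd ?_ h5)
          have := P.self_split hcd hd
          omega
      · rcases Nat.eq_zero_or_pos a with rfl | h0
        · rw [wrap_zero]
          refine .right_end _ _ _ P.last_arc h3.le fun x y hxy hx hy _ => ?_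
          have := P.neg_first hab hxy hx
          omega
        · obtain ⟨b', hb', hbb'⟩ := P.neg_longer hab h1 h3 h0
          rw [wrap_pos ℓ h0]
          refine .right_turn _ _ _ a b' _ P.last_arc h3.le hb' h1 hbb' (P.neg_arc_lt hb')
            (fun x y hxy hx hy _ => P.neg_next hab h1 h3 hb' hxy hx hy) ?_
          refine .left_end _ _ _ hb' h1 (by omega) fun c d hcd h4 h5 h6 => ?_
          rcases P.self_arc_cases hcd with ⟨rfl, rfl⟩ | ⟨hd, hcd⟩
          · omega
          · have := P.self_split hcd hd
            omega
  | left_turn a b q c d j hab haq hqb hcd hac hcq hbd hmax _ ih =>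
    intro a' ha' hq
    have h1 := hab.lt
    have hsame := P.neg_same_closer hab ha'
    have hdm : d ≠ m := by
      rintro rfl
      have := hcd.opener_unique P.first
      omega
    have hs := P.self_split hcd hdm
    have hcd' := P.self_arc hcd hdm
    refine .left_turn _ _ _ c d _ ha' (by have := ha'.lt; omega) hqb hcd' (by omega) hcq hbd ?_
      (ih hdm)
    intro x y hxy h2 h3 h4
    rcases P.self_arc_cases hxy with ⟨rfl, rfl⟩ | ⟨hy, hxy⟩
    · omega
    · refine hmax x y hxy ?_ h3 h4
      have := P.self_split hxy hy
      omega

/-- Walks traversing the arcs of colour `X` leftwards. If they reach the arc `(0, m)`, they turn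
into an arc that passes over `m` and terminate at its end; in the promoted word the arc from which
they came leads there directly. -/
theorem walk_neg (P : Promotes f f' X m ℓ) {x : Dir} {a b p j : ℕ}
    (h : Walk (IsArc f (-X)) (IsArc f X) x a b p j) :
    match x with
    | .right =>
        (b < m ∨ m < a → Walk (IsArc f' (-X)) (IsArc f' X) .right a b p (wrap ℓ j)) ∧
        (a < m → m < b → (m ≤ p → j = b) ∧ (p < m → a ≠ 0 → ∀ b', IsArc f' (-X) a b' →
          Walk (IsArc f' (-X)) (IsArc f' X) .right a b' p (wrap ℓ j)))
    | .left =>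
        (b ≠ m → Walk (IsArc f' (-X)) (IsArc f' X) .left a b p (wrap ℓ j)) ∧
        (b = m → ∃ c, IsArc f (-X) c j ∧ c < p ∧ m < j ∧
          ∀ c' d', IsArc f (-X) c' d' → c' < p → m < d' → c' ≤ c) := by
  have hml := P.lt
  have h0m := P.m_pos
  -- the arcs passing over the end of an arc of colour `X` other than the first one
  have passes : ∀ {a b c d : ℕ}, IsArc f X a b → b ≠ m → IsArc f' (-X) c d → a ≤ c → c < b →
      b < d → ∃ d0, IsArc f (-X) c d0 ∧ b < d0 := by
    intro a b c d hab hb hcd hac hcb hbd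
    have hs := P.self_split hab hb
    have hbl := P.arc_lt P.ne_A hab
    have hfc : f c = .A := by
      rw [← P.else' c (by omega) (by omega) (by omega), hcd.opener]
    obtain ⟨d0, hd0⟩ := P.exists_closer P.neg_ne_A (by omega) hfc
    refine ⟨d0, hd0, ?_⟩
    by_contra hle
    have := hcd.closer_unique (P.neg_arc hd0 (by
      have := P.neg_closer_ne hd0
      omega))
    omega
  induction h with
  | right_end c d p hcd hcp hno =>
    have hd0 := hcd.lt
    refine ⟨fun hs => ?_, fun h1 h2 => ⟨fun _ => rfl, fun h3 _ => ?_⟩⟩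
    · rw [wrap_pos ℓ (by omega)]
      refine .right_end _ _ _ (P.neg_arc hcd hs) hcp fun a b hab h1 h2 h3 => ?_
      have hdl := P.arc_lt P.neg_ne_A hcd
      rcases P.self_arc_cases hab with ⟨rfl, rfl⟩ | ⟨_, hab⟩
      · omega
      · exact hno a b hab h1 h2 h3
    · exact absurd h2 (hno 0 m P.first (Nat.zero_le _) h3)
  | right_turn c d p a b j hcd hcp hab hac hpb hbd hmin _ ih =>
    refine ⟨fun hs => ?_, fun h1 h2 => ⟨fun h3 => ?_, fun h3 h4 d' hd' => ?_⟩⟩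
    · have hbm : b ≠ m := by
        rintro rfl
        omega
      refine .right_turn _ _ _ a b _ (P.neg_arc hcd hs) hcp (P.self_arc hab hbm) hac hpb hbd ?_
        (ih.1 hbm)
      intro x y hxy h1 h2 h3
      have hdl := P.arc_lt P.neg_ne_A hcd
      rcases P.self_arc_cases hxy with ⟨rfl, rfl⟩ | ⟨_, hxy⟩
      · omega
      · exact hmin x y hxy h1 h2 h3
    · have := P.self_split hab (by omega)
      omega
    · obtain ⟨d2, hd2, hdd2⟩ := P.neg_longer hcd h1 h2 (by omega)
      obtain rfl := hd2.closer_unique hd'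
      have hbm := hmin 0 m P.first (Nat.zero_le _) h3 h2
      rcases Nat.lt_or_eq_of_le hbm with hlt | rfl
      · refine .right_turn _ _ _ a b _ hd' hcp (P.self_arc hab hlt.ne) hac hpb (by omega) ?_
          (ih.1 hlt.ne)
        intro x y hxy h5 h6 h7
        rcases P.self_arc_cases hxy with ⟨rfl, rfl⟩ | ⟨hy, hxy⟩
        · omega
        · by_cases hyd : y < d
          · exact hmin x y hxy h5 h6 hyd
          · omega
      · obtain ⟨c1, hc1, hc1c, hbj, hmax⟩ := ih.2 rfl
        -- the new arc from `c` ends where the next longer arc over `m` ended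
        have hjd : j = d2 := by
          apply le_antisymm
          · obtain ⟨x0, hx0⟩ := P.neg_exists_old hd2
            have hx0c : x0 < c := by
              have hd2x := P.neg_same_closer hx0 hd2
              rcases lt_trichotomy x0 c with h5 | rfl | h5
              · exact h5
              · have := hcd.closer_unique hx0
                omega
              · have := hcd.nested hx0 h5 (by omega)
                omega
            rcases Nat.lt_or_eq_of_le (hmax x0 d2 hx0 hx0c (by omega)) with h5 | rfl
            · exact (hx0.nested hc1 h5 (by omega)).le
            · exact (hc1.closer_unique hx0).le
          · obtain ⟨x, hx⟩ := P.neg_exists_new hc1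
            have h5 := P.neg_same_closer hc1 hx
            have h6 := hc1.nested hcd hc1c (by omega)
            exact P.neg_next hcd h1 h2 hd2 hx (by omega) h6
        rw [wrap_pos ℓ (by omega), hjd]
        refine .right_end _ _ _ hd2 hcp fun x y hxy h5 h6 h7 => ?_
        rcases P.self_arc_cases hxy with ⟨rfl, rfl⟩ | ⟨hy, hxy⟩
        · omega
        · have h8 := P.self_split hxy hy
          have := hmin x y hxy h5 h6 (by omega)
          omega
  | left_end a b q hab haq hqb hno =>
    refine ⟨fun hb => ?_, fun hb => ?_⟩
    · have hs := P.self_split hab hb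
      rw [wrap_pos ℓ (by omega)]
      refine .left_end _ _ _ (P.self_arc hab hb) haq hqb fun c d hcd h1 h2 h3 => ?_
      obtain ⟨d0, hd0, hbd0⟩ := passes hab hb hcd h1 (by omega) h3
      exact hno c d0 hd0 h1 h2 hbd0
    · subst hb
      obtain rfl := hab.opener_unique P.first
      obtain ⟨d, hd⟩ := P.exists_closer P.neg_ne_A (by omega) P.f_zero
      refine absurd ?_ (hno 0 d hd le_rfl haq)
      by_contra hdm
      have := P.pos (d + 1) (by omega) (by omega)
      rw [hd.closes, excess_zero] at this
      omega
  | left_turn a b q c d j hab haq hqb hcd hac hcq hbd hmax _ ih =>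
    refine ⟨fun hb => ?_, fun hb => ?_⟩
    · have hs := P.self_split hab hb
      have hmax' : ∀ c' d', IsArc f' (-X) c' d' → a ≤ c' → c' < q → b < d' → c' ≤ c := by
        intro x y hxy h1 h2 h3
        obtain ⟨d0, hd0, hbd0⟩ := passes hab hb hxy h1 (by omega) h3
        exact hmax x d0 hd0 h1 h2 hbd0
      by_cases hcs : d < m ∨ m < c
      · exact .left_turn _ _ _ c d _ (P.self_arc hab hb) haq hqb (P.neg_arc hcd hcs) hac hcq hbd
          hmax' (ih.1 hcs)
      · have h1 := P.neg_closer_ne hcd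
        have h2 := P.neg_opener_ne hcd
        obtain ⟨d', hd', hdd'⟩ := P.neg_longer hcd (by omega) (by omega) (by omega)
        exact .left_turn _ _ _ c d' _ (P.self_arc hab hb) haq hqb hd' hac hcq (by omega)
          hmax' ((ih.2 (by omega) (by omega)).2 (by omega) (by omega) d' hd')
    · subst hb
      obtain rfl := hab.opener_unique P.first
      have := (ih.2 (by omega) hbd).1 le_rfl
      subst this
      exact ⟨c, hcd, hcq, hbd, fun c' d' h1 h2 h3 => hmax c' d' h1 (Nat.zero_le _) h2 h3⟩

end Promotes

/-! ### Promotion rotates the trip permutation -/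

theorem excess_shift {f g : ℕ → Letter} {N : ℕ} (h : ∀ k < N, g k = f (k + 1)) (ε : Letter)
    {k : ℕ} (hk : k ≤ N) : excess f ε (k + 1) = excess g ε k + excess f ε 1 := by
  induction k with
  | zero => simp [excess]
  | succ k ih =>
    rw [excess_succ f, ih (by omega), excess_succ g, h k hk]
    omega

theorem isArc_shift {f g : ℕ → Letter} {N : ℕ} (h : ∀ k < N, g k = f (k + 1)) {ε : Letter}
    {a b : ℕ} (hb : b < N) : IsArc g ε a b ↔ IsArc f ε (a + 1) (b + 1) := by
  have e : ∀ k ≤ N, excess f ε (k + 1) = excess g ε k + excess f ε 1 :=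
    fun k hk => excess_shift h ε hk
  constructor
  · rintro ⟨h1, h2, h3, h4, h5⟩
    have ea := e a (by omega)
    refine ⟨by rw [← h a (by omega), h1], by rw [← h b hb, h2], by omega, ?_, ?_⟩
    · rw [e (b + 1) hb, h4, ea]
    · intro k hk hkb
      obtain ⟨k, rfl⟩ : ∃ l, k = l + 1 := ⟨k - 1, by omega⟩
      have := h5 k (by omega) (by omega)
      have := e k (by omega)
      omega
  · rintro ⟨h1, h2, h3, h4, h5⟩
    have ea := e a (by omega)
    have eb := e (b + 1) hb
    refine ⟨by rw [h a (by omega), h1], by rw [h b hb, h2], by omega, by omega, ?_⟩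
    intro k hk hkb
    have := h5 (k + 1) (by omega) (by omega)
    have := e k (by omega)
    omega

theorem Walk.shift {R L R' L' : ℕ → ℕ → Prop} (hR : ∀ a b, R a b → R' (a + 1) (b + 1))
    (hL : ∀ a b, L a b → L' (a + 1) (b + 1))
    (hR' : ∀ a b, R' a b → ∃ a0 b0, a = a0 + 1 ∧ b = b0 + 1 ∧ R a0 b0)
    (hL' : ∀ a b, L' a b → ∃ a0 b0, a = a0 + 1 ∧ b = b0 + 1 ∧ L a0 b0)
    {x : Dir} {a b p j : ℕ} (h : Walk R L x a b p j) :
    Walk R' L' x (a + 1) (b + 1) (p + 1) (j + 1) := by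
  induction h with
  | right_end c d p hcd hcp hno =>
    refine .right_end _ _ _ (hR _ _ hcd) (by omega) fun a b hab h1 h2 h3 => ?_
    obtain ⟨a, b, rfl, rfl, h4⟩ := hL' _ _ hab
    exact hno a b h4 (by omega) (by omega) (by omega)
  | right_turn c d p a b j hcd hcp hab hac hpb hbd hmin _ ih =>
    refine .right_turn _ _ _ _ _ _ (hR _ _ hcd) (by omega) (hL _ _ hab) (by omega) (by omega)
      (by omega) (fun x y hxy h1 h2 h3 => ?_) ih
    obtain ⟨x, y, rfl, rfl, h4⟩ := hL' _ _ hxy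
    have := hmin x y h4 (by omega) (by omega) (by omega)
    omega
  | left_end a b q hab haq hqb hno =>
    refine .left_end _ _ _ (hL _ _ hab) (by omega) (by omega) fun c d hcd h1 h2 h3 => ?_
    obtain ⟨c, d, rfl, rfl, h4⟩ := hR' _ _ hcd
    exact hno c d h4 (by omega) (by omega) (by omega)
  | left_turn a b q c d j hab haq hqb hcd hac hcq hbd hmax _ ih =>
    refine .left_turn _ _ _ _ _ _ (hL _ _ hab) (by omega) (by omega) (hR _ _ hcd) (by omega)
      (by omega) (by omega) (fun x y hxy h1 h2 h3 => ?_) ih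
    obtain ⟨x, y, rfl, rfl, h4⟩ := hR' _ _ hxy
    have := hmax x y h4 (by omega) (by omega) (by omega)
    omega

theorem finRotate_val {N : ℕ} (k : Fin N) :
    (finRotate N k : ℕ) = if (k : ℕ) + 1 = N then 0 else (k : ℕ) + 1 := by
  obtain _ | N := N
  · exact k.elim0
  · rw [coe_finRotate]
    simp [Fin.ext_iff]

namespace Promotes

variable {n : ℕ} {w u : KWord n} {f' : ℕ → Letter} {X : Letter} {m : ℕ}

theorem new_arc_le (P : Promotes w.extend f' X m (3 * n)) {ε : Letter} (hε : ε ≠ .A) {a b : ℕ}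
    (h : IsArc f' ε a b) : 0 < a ∧ b ≤ 3 * n := by
  constructor
  · rcases Nat.eq_zero_or_pos a with rfl | h0
    · exact absurd (h.opener.symm.trans P.zero').symm P.ne_A
    · exact h0
  · rcases Letter.eq_or_eq_neg P.ne_A hε with rfl | rfl
    · rcases P.self_arc_cases h with h | ⟨-, h⟩
      · exact h.2.le
      · exact (P.arc_lt P.ne_A h).le
    · exact (P.neg_arc_lt h).le

theorem arc_shift (P : Promotes w.extend f' X m (3 * n))
    (hu : ∀ k < 3 * n, u.extend k = f' (k + 1)) {ε : Letter} (hε : ε ≠ .A) {a b : ℕ}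
    (h : IsArc f' ε a b) : ∃ a0 b0, a = a0 + 1 ∧ b = b0 + 1 ∧ IsArc u.extend ε a0 b0 := by
  have h1 := P.new_arc_le hε h
  have h2 := h.lt
  obtain ⟨a, rfl⟩ : ∃ l, a = l + 1 := ⟨a - 1, by omega⟩
  obtain ⟨b, rfl⟩ : ∃ l, b = l + 1 := ⟨b - 1, by omega⟩
  exact ⟨a, b, rfl, rfl, (isArc_shift hu (by omega)).2 h⟩

theorem walk_shift (P : Promotes w.extend f' X m (3 * n))
    (hu : ∀ k < 3 * n, u.extend k = f' (k + 1)) {ε : Letter} (hε : ε ≠ .A) {x : Dir}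
    {a b p j : ℕ} (h : KWord.ColourWalk u.extend ε x a b p j) :
    KWord.ColourWalk f' ε x (a + 1) (b + 1) (p + 1) (j + 1) :=
  Walk.shift (fun _ _ h => (isArc_shift hu (u.arc_lt hε h)).1 h)
    (fun _ _ h => (isArc_shift hu (u.arc_lt (Letter.neg_ne_A hε) h)).1 h)
    (fun _ _ h => P.arc_shift hu hε h) (fun _ _ h => P.arc_shift hu (Letter.neg_ne_A hε) h) h

theorem tripPerm_of_closer (P : Promotes w.extend f' X m (3 * n))
    (hu : ∀ k < 3 * n, u.extend k = f' (k + 1)) {ε : Letter} (hε : ε ≠ .A) {i k : Fin (3 * n)}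
    (hk : (i : ℕ) = k + 1) {a j : ℕ} (h : IsArc f' (-ε) a i)
    (hw : KWord.ColourWalk f' ε .left a i i j) : (u.tripPerm k : ℕ) + 1 = j := by
  obtain ⟨a, b, rfl, hb, h⟩ := P.arc_shift hu (Letter.neg_ne_A hε) h
  obtain rfl : b = k := by omega
  have := P.walk_shift hu hε (u.walk_of_closer hε h)
  rw [← hk] at this
  exact this.deterministic hw

theorem tripPerm_of_opener (P : Promotes w.extend f' X m (3 * n))
    (hu : ∀ k < 3 * n, u.extend k = f' (k + 1)) {ε : Letter} (hε : ε ≠ .A) {i k : Fin (3 * n)}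
    (hk : (i : ℕ) = k + 1) {d x : ℕ} (h : IsArc f' ε i d) (hx : IsArc f' (-ε) i x)
    (hdx : d < x) : (u.tripPerm k : ℕ) + 1 = d := by
  obtain ⟨a, d, ha, rfl, h⟩ := P.arc_shift hu hε h
  obtain ⟨a', x, ha', rfl, hx⟩ := P.arc_shift hu (Letter.neg_ne_A hε) hx
  obtain rfl : a = k := by omega
  obtain rfl : a' = k := by omega
  rw [u.tripPerm_of_opener hε h hx (by omega)]

theorem tripPerm_shift (P : Promotes w.extend f' X m (3 * n))
    (hu : ∀ k < 3 * n, u.extend k = f' (k + 1)) {i k : Fin (3 * n)} (hk : (i : ℕ) = k + 1) :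
    (u.tripPerm k : ℕ) + 1 = wrap (3 * n) (w.tripPerm i) := by
  have hX := P.ne_A
  have hZ := P.neg_ne_A
  have hml := P.lt
  have hnn := Letter.neg_neg' X
  by_cases hi : w.extend i = .A
  · have him : (i : ℕ) ≠ m := fun h => hX (P.f_m.symm.trans (h ▸ hi))
    obtain ⟨x, hx⟩ := P.exists_closer hX i.isLt hi
    obtain ⟨z, hz⟩ := P.exists_closer hZ i.isLt hi
    have hxm : x ≠ m := by
      rintro rfl
      have := hx.opener_unique P.first
      omega
    have hs := P.self_split hx hxm
    have hx' := P.self_arc hx hxm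
    have hxl := hx.lt
    have hzl := hz.lt
    -- the arc of the other colour can only become longer, and then it was the longer one
    have hz' : ∃ z', IsArc f' (-X) i z' ∧ z ≤ z' ∧ (x < z ∨ z = z') := by
      by_cases h : z < m ∨ m < (i : ℕ)
      · exact ⟨z, P.neg_arc hz h, le_rfl, Or.inr rfl⟩
      · have := P.neg_closer_ne hz
        obtain ⟨z', h1, h2⟩ := P.neg_longer hz (by omega) (by omega) (by omega)
        exact ⟨z', h1, h2.le, Or.inl (by omega)⟩
    obtain ⟨z', hz', h1, h2⟩ := hz'
    have hxz : x ≠ z := by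
      rintro rfl
      exact Letter.neg_ne_self hX (hz.closer.symm.trans hx.closer)
    rcases Nat.lt_or_gt_of_ne hxz with h3 | h3
    · rw [w.tripPerm_of_opener hX hx hz h3, wrap_pos _ (by omega)]
      exact P.tripPerm_of_opener hu hX hk hx' hz' (by omega)
    · obtain rfl : z = z' := by omega
      rw [w.tripPerm_of_opener hZ hz (by rwa [hnn]) h3, wrap_pos _ (by omega)]
      exact P.tripPerm_of_opener hu hZ hk hz' (by rwa [hnn]) h3
  · rcases Letter.eq_or_eq_neg hX hi with hi | hi
    · obtain ⟨a, ha⟩ := P.exists_opener hX hi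
      have hw := w.walk_of_closer hZ (i := i) (by rwa [hnn])
      unfold KWord.ColourWalk at hw
      rw [hnn] at hw
      have hw' := P.walk_neg hw
      by_cases him : (i : ℕ) = m
      · obtain ⟨c, hc, hcm, hmj, hmax⟩ := hw'.2 him
        rw [him] at hcm
        obtain ⟨d, hd⟩ := u.exists_arc_of_opener hZ k.isLt
          (by rw [hu k k.isLt, ← hk, him, P.turn'])
        have hd := (isArc_shift hu (u.arc_lt hZ hd)).1 hd
        rw [← hk] at hd
        have hdl := P.neg_arc_lt hd
        have h1 := P.tripPerm_of_opener hu hZ hk hd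
          (by rw [hnn, him]; exact P.last_arc) hdl
        rw [h1, wrap_pos _ (by omega)]
        rw [him] at hd
        -- both are the first end of an arc over `m`
        apply le_antisymm
        · obtain ⟨x, hx⟩ := P.neg_exists_new hc
          have h2 := P.neg_same_closer hc hx
          rcases Nat.lt_or_eq_of_le (show x ≤ m by omega) with h3 | rfl
          · exact (hx.nested hd h3 hmj).le
          · exact (hd.closer_unique hx).le
        · obtain ⟨x, hx⟩ := P.neg_exists_old hd
          have h2 := P.neg_same_closer hx hd
          have h3 := P.neg_opener_ne hx
          rcases Nat.lt_or_eq_of_le (hmax x _ hx (by omega) (by omega)) with h4 | rfl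
          · exact (hx.nested hc h4 (by omega)).le
          · exact (hc.closer_unique hx).le
      · refine P.tripPerm_of_closer hu hZ hk (a := a) ?_ ?_
        · rw [hnn]
          exact P.self_arc ha him
        · unfold KWord.ColourWalk
          rw [hnn]
          exact hw'.1 him
    · obtain ⟨a, ha⟩ := P.exists_opener hZ hi
      obtain ⟨a', ha'⟩ := P.neg_exists_new ha
      refine P.tripPerm_of_closer hu hX hk ha' (P.walk_self (w.walk_of_closer hX ha) a' ha' ?_)
      have := P.neg_closer_ne ha
      omega

/-- Promotion conjugates the trip permutation by the long cycle. -/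
theorem tripPerm_rotate (P : Promotes w.extend f' X m (3 * n))
    (hu : ∀ k < 3 * n, u.extend k = f' (k + 1)) (k : Fin (3 * n)) :
    finRotate _ (u.tripPerm k) = w.tripPerm (finRotate _ k) := by
  -- away from the last place this is `tripPerm_shift`, and a permutation is determined by its
  -- values at all places but one
  have hmain : ∀ k : Fin (3 * n), (finRotate _ k : ℕ) ≠ 0 →
      finRotate _ (u.tripPerm k) = w.tripPerm (finRotate _ k) := by
    intro k hk0
    have h1 := finRotate_val k
    have h2 := finRotate_val (u.tripPerm k)
    have h3 := P.tripPerm_shift hu (i := finRotate _ k) (k := k) (by split_ifs at h1 <;> omega)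
    apply Fin.ext
    rw [h2]
    unfold wrap at h3
    have := (w.tripPerm (finRotate _ k)).isLt
    split_ifs at h3 ⊢ <;> omega
  by_cases hk : (finRotate _ k : ℕ) ≠ 0
  · exact hmain k hk
  · obtain ⟨l, hl⟩ : ∃ l, finRotate _ (u.tripPerm l) = w.tripPerm (finRotate _ k) :=
      ⟨u.tripPerm.symm ((finRotate _).symm (w.tripPerm (finRotate _ k))), by
        rw [Equiv.apply_symm_apply, Equiv.apply_symm_apply]⟩
    by_cases hl0 : (finRotate _ l : ℕ) ≠ 0
    · rw [hmain l hl0] at hl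
      have := w.tripPerm.injective hl
      rw [this] at hl0
      exact absurd hl0 hk
    · have : finRotate _ l = finRotate _ k := Fin.ext (by omega)
      rw [(finRotate _).injective this] at hl
      exact hl

end Promotes

/-! ### Promotion and evacuation of linear extensions -/

namespace LinExt

variable {P : Type*} [PartialOrder P] {ℓ : ℕ}

/-- Promotion: `τ_{ℓ-1} ∘ ⋯ ∘ τ_2 ∘ τ_1`. -/
noncomputable def promotion (L : LinExt P ℓ) : LinExt P ℓ := sweep (ℓ - 1) L

theorem tau_of_not_mem (L : LinExt P ℓ) {i : ℕ} (h : ¬ (1 ≤ i ∧ i < ℓ)) : tau i L = L := dif_neg h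

theorem not_succ_le (L : LinExt P ℓ) {k : ℕ} (hk : k + 1 < ℓ) :
    ¬ L.seq ⟨k + 1, hk⟩ ≤ L.seq ⟨k, by omega⟩ := fun h => by
  have := Fin.le_def.mp (L.le_of_le _ _ h)
  dsimp only at this
  omega

theorem tau_of_le (L : LinExt P ℓ) {k : ℕ} (hk : k + 1 < ℓ)
    (h : L.seq ⟨k, by omega⟩ ≤ L.seq ⟨k + 1, hk⟩) : tau (k + 1) L = L := by
  unfold tau
  rw [dif_pos ⟨by omega, hk⟩, dif_neg fun h' => h'.1 h]

theorem tau_seq_of_not_le (L : LinExt P ℓ) {k : ℕ} (hk : k + 1 < ℓ)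
    (h : ¬ L.seq ⟨k, by omega⟩ ≤ L.seq ⟨k + 1, hk⟩) (j : Fin ℓ) :
    (tau (k + 1) L).seq j = L.seq (Equiv.swap ⟨k, by omega⟩ ⟨k + 1, hk⟩ j) := by
  unfold tau
  rw [dif_pos ⟨by omega, hk⟩, dif_pos ⟨h, L.not_succ_le hk⟩]
  rfl

theorem tau_seq_of_ne (L : LinExt P ℓ) {i : ℕ} {j : Fin ℓ} (h1 : (j : ℕ) + 1 ≠ i)
    (h2 : (j : ℕ) ≠ i) : (tau i L).seq j = L.seq j := by
  by_cases hi : 1 ≤ i ∧ i < ℓ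
  · obtain ⟨k, rfl⟩ : ∃ k, i = k + 1 := ⟨i - 1, by omega⟩
    by_cases h : L.seq ⟨k, by omega⟩ ≤ L.seq ⟨k + 1, hi.2⟩
    · rw [L.tau_of_le hi.2 h]
    · rw [L.tau_seq_of_not_le hi.2 h,
        Equiv.swap_apply_of_ne_of_ne (fun h => h1 (by rw [h])) (fun h => h2 (by rw [h]))]
  · rw [L.tau_of_not_mem hi]

theorem tau_tau (i : ℕ) (L : LinExt P ℓ) : tau i (tau i L) = L := by
  by_cases hi : 1 ≤ i ∧ i < ℓ
  · obtain ⟨k, rfl⟩ : ∃ k, i = k + 1 := ⟨i - 1, by omega⟩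
    by_cases h : L.seq ⟨k, by omega⟩ ≤ L.seq ⟨k + 1, hi.2⟩
    · rw [L.tau_of_le hi.2 h, L.tau_of_le hi.2 h]
    · have h' : ¬ (tau (k + 1) L).seq ⟨k, by omega⟩ ≤ (tau (k + 1) L).seq ⟨k + 1, hi.2⟩ := by
        rw [L.tau_seq_of_not_le hi.2 h, L.tau_seq_of_not_le hi.2 h, Equiv.swap_apply_left,
          Equiv.swap_apply_right]
        exact L.not_succ_le hi.2
      apply LinExt.ext
      ext1 j
      rw [tau_seq_of_not_le _ hi.2 h', L.tau_seq_of_not_le hi.2 h, Equiv.swap_apply_self]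
  · rw [tau_of_not_mem _ hi, tau_of_not_mem _ hi]

theorem tau_comm {i j : ℕ} (hij : i + 1 < j) (L : LinExt P ℓ) :
    tau i (tau j L) = tau j (tau i L) := by
  by_cases hi : 1 ≤ i ∧ i < ℓ
  swap
  · rw [tau_of_not_mem _ hi, tau_of_not_mem _ hi]
  by_cases hj : 1 ≤ j ∧ j < ℓ
  swap
  · rw [tau_of_not_mem _ hj, tau_of_not_mem _ hj]
  obtain ⟨k, rfl⟩ : ∃ k, i = k + 1 := ⟨i - 1, by omega⟩
  obtain ⟨l, rfl⟩ : ∃ l, j = l + 1 := ⟨j - 1, by omega⟩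
  have e1 : (tau (l + 1) L).seq ⟨k, by omega⟩ = L.seq ⟨k, by omega⟩ :=
    tau_seq_of_ne _ (by dsimp only; omega) (by dsimp only; omega)
  have e2 : (tau (l + 1) L).seq ⟨k + 1, hi.2⟩ = L.seq ⟨k + 1, hi.2⟩ :=
    tau_seq_of_ne _ (by dsimp only; omega) (by dsimp only; omega)
  have e3 : (tau (k + 1) L).seq ⟨l, by omega⟩ = L.seq ⟨l, by omega⟩ :=
    tau_seq_of_ne _ (by dsimp only; omega) (by dsimp only; omega)
  have e4 : (tau (k + 1) L).seq ⟨l + 1, hj.2⟩ = L.seq ⟨l + 1, hj.2⟩ :=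
    tau_seq_of_ne _ (by dsimp only; omega) (by dsimp only; omega)
  by_cases h1 : L.seq ⟨k, by omega⟩ ≤ L.seq ⟨k + 1, hi.2⟩
  · rw [L.tau_of_le hi.2 h1, tau_of_le _ hi.2 (by rwa [e1, e2])]
  · by_cases h2 : L.seq ⟨l, by omega⟩ ≤ L.seq ⟨l + 1, hj.2⟩
    · rw [L.tau_of_le hj.2 h2, tau_of_le _ hj.2 (by rwa [e3, e4])]
    · apply LinExt.ext
      ext1 x
      rw [tau_seq_of_not_le _ hi.2 (by rwa [e1, e2]), L.tau_seq_of_not_le hj.2 h2,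
        tau_seq_of_not_le _ hj.2 (by rwa [e3, e4]), L.tau_seq_of_not_le hi.2 h1]
      congr 1
      clear e1 e2 e3 e4 h1 h2
      simp only [Equiv.swap_apply_def, Fin.ext_iff]
      split_ifs <;> first | rfl | (dsimp only at *; omega)

theorem tau_sweep {i m : ℕ} (h : m + 1 < i) (L : LinExt P ℓ) :
    tau i (sweep m L) = sweep m (tau i L) := by
  induction m with
  | zero => rfl
  | succ m ih => rw [sweep, sweep, ← ih (by omega), tau_comm h]

theorem tau_sweeps {i m : ℕ} (h : m + 1 < i) (L : LinExt P ℓ) :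
    tau i (sweeps m L) = sweeps m (tau i L) := by
  induction m generalizing L with
  | zero => rfl
  | succ m ih => rw [sweeps, sweeps, ih (by omega), tau_sweep h]

/-- Since `τ_i` and `τ_j` commute for `|i - j| > 1`, the last steps of the nested sweeps can be pulled
out on the left: `sweeps (m + 1)` is also `sweeps m` followed by the inverse of `sweep (m + 1)`. -/
theorem sweep_sweeps (m : ℕ) (L : LinExt P ℓ) :
    sweep (m + 1) (sweeps (m + 1) L) = sweeps m L := by
  induction m generalizing L with
  | zero => exact tau_tau 1 L
  | succ m ih =>
    rw [sweep, sweeps, ih, tau_sweeps (by omega), sweep, tau_tau, sweeps]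

/-- Evacuation conjugates promotion to its inverse. -/
theorem promotion_evac_promotion (L : LinExt P ℓ) : L.promotion.evac.promotion = L.evac := by
  unfold promotion evac
  generalize ℓ - 1 = m
  cases m with
  | zero => rfl
  | succ m => rw [sweep_sweeps, sweeps]

theorem sweep_seq_of_lt (L : LinExt P ℓ) {m : ℕ} {j : Fin ℓ} (h : m < j) :
    (sweep m L).seq j = L.seq j := by
  induction m with
  | zero => rfl
  | succ m ih => rw [sweep, tau_seq_of_ne _ (by omega) (by omega), ih (by omega)]

theorem sweeps_seq_of_lt (L : LinExt P ℓ) {m : ℕ} {j : Fin ℓ} (h : m < j) :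
    (sweeps m L).seq j = L.seq j := by
  induction m generalizing L with
  | zero => rfl
  | succ m ih => rw [sweeps, ih _ (by omega), sweep_seq_of_lt _ h]

theorem sweep_seq_stable (L : LinExt P ℓ) {m r : ℕ} (hmr : m ≤ r) {j : Fin ℓ} (h : j < m) :
    (sweep r L).seq j = (sweep m L).seq j := by
  induction r, hmr using Nat.le_induction with
  | base => rfl
  | succ r hr ih => rw [sweep, tau_seq_of_ne _ (by omega) (by omega), ih]

theorem tau_seq_congr {L L' : LinExt P ℓ} {M i : ℕ} (hi : i ≤ M)
    (h : ∀ j : Fin ℓ, (j : ℕ) ≤ M → L.seq j = L'.seq j) (j : Fin ℓ) (hj : (j : ℕ) ≤ M) :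
    (tau i L).seq j = (tau i L').seq j := by
  by_cases hi' : 1 ≤ i ∧ i < ℓ
  · obtain ⟨k, rfl⟩ : ∃ k, i = k + 1 := ⟨i - 1, by omega⟩
    have e1 := h ⟨k, by omega⟩ (by dsimp only; omega)
    have e2 := h ⟨k + 1, hi'.2⟩ hi
    by_cases hle : L.seq ⟨k, by omega⟩ ≤ L.seq ⟨k + 1, hi'.2⟩
    · rw [L.tau_of_le hi'.2 hle, L'.tau_of_le hi'.2 (by rwa [← e1, ← e2]), h j hj]
    · rw [L.tau_seq_of_not_le hi'.2 hle, L'.tau_seq_of_not_le hi'.2 (by rwa [← e1, ← e2])]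
      apply h
      rw [Equiv.swap_apply_def]
      split_ifs <;> first | omega | (dsimp only; omega)
  · rw [tau_of_not_mem _ hi', tau_of_not_mem _ hi', h j hj]

theorem sweep_seq_congr {L L' : LinExt P ℓ} {M m : ℕ} (hm : m ≤ M)
    (h : ∀ j : Fin ℓ, (j : ℕ) ≤ M → L.seq j = L'.seq j) (j : Fin ℓ) (hj : (j : ℕ) ≤ M) :
    (sweep m L).seq j = (sweep m L').seq j := by
  induction m generalizing j with
  | zero => exact h j hj
  | succ m ih => exact tau_seq_congr hm (ih (by omega)) j hj

/-- After `k` of the nested sweeps, the first entries are those of the `k`-fold promotion, because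
a longer sweep does not change them again. -/
theorem sweeps_seq {k m : ℕ} (hk : m + k < ℓ) {L L' : LinExt P ℓ}
    (h : ∀ j : Fin ℓ, (j : ℕ) ≤ m + k → L.seq j = L'.seq j) :
    (sweeps (m + k) L).seq ⟨m, by omega⟩ = (sweep m (promotion^[k] L')).seq ⟨m, by omega⟩ := by
  induction k generalizing L L' with
  | zero =>
    have hc := sweep_seq_congr (le_refl m) h ⟨m, by omega⟩ le_rfl
    cases m with
    | zero => exact hc
    | succ m =>
      change (sweeps m (sweep (m + 1) L)).seq _ = _
      rw [sweeps_seq_of_lt _ (by dsimp only; omega), hc]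
      rfl
  | succ k ih =>
    rw [← Nat.add_assoc, sweeps, Function.iterate_succ_apply]
    refine ih (by omega) fun j hj => ?_
    rw [sweep_seq_congr (M := m + k + 1) le_rfl h j (by omega)]
    exact (sweep_seq_stable L' (by omega) (by omega)).symm

theorem evac_seq (L : LinExt P ℓ) (i : Fin ℓ) :
    L.evac.seq i = (sweep i (promotion^[ℓ - 1 - i] L)).seq i := by
  have h := i.isLt
  have this : (sweeps (i + (ℓ - 1 - i)) L).seq ⟨i, h⟩ =
      (sweep i (promotion^[ℓ - 1 - i] L)).seq ⟨i, h⟩ :=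
    sweeps_seq (by omega) fun _ _ => rfl
  rwa [show (i : ℕ) + (ℓ - 1 - i) = ℓ - 1 by omega] at this

end LinExt

/-! ### Promotion and evacuation of Kreweras words -/

namespace KWord

variable {n : ℕ}

/-- Promotion of Kreweras words. -/
noncomputable def promotion (w : KWord n) : KWord n :=
  linExtEquiv n ((linExtEquiv n).symm w).promotion

theorem promotion_evac_promotion (w : KWord n) : w.promotion.evac.promotion = w.evac := by
  simp only [promotion, evac, Equiv.symm_apply_apply, LinExt.promotion_evac_promotion]

theorem symm_iterate_promotion (w : KWord n) (k : ℕ) :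
    (linExtEquiv n).symm (promotion^[k] w) = LinExt.promotion^[k] ((linExtEquiv n).symm w) := by
  refine (Function.Semiconj.iterate_right (f := (linExtEquiv n).symm) (fun w => ?_) k) w
  simp [promotion]

/-- The letter `X` at `m` closes the shorter one of the two arcs from the first letter: it is the
first letter at which the number of `A`'s becomes that of `B`'s or that of `C`'s. -/
structure IsFirstReturn (w : KWord n) (X : Letter) (m : ℕ) : Prop where
  ne_A : X ≠ .A
  first : IsArc w.extend X 0 m
  pos : ∀ k, 0 < k → k ≤ m + 1 → 0 < excess w.extend (-X) k

theorem extend_zero (w : KWord n) : w.extend 0 = .A := by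
  by_cases hn : 0 < 3 * n
  · have hB := w.excess_nonneg (ε := .B) (by decide) hn
    have hC := w.excess_nonneg (ε := .C) (by decide) hn
    rw [excess_succ, show ∀ ε, excess w.extend ε 0 = 0 from fun _ => rfl] at hB hC
    rcases h : w.extend 0 with _ | _ | _
    · rfl
    · rw [h] at hB
      exact absurd hB (by decide)
    · rw [h] at hC
      exact absurd hC (by decide)
  · exact dif_neg hn

theorem isFirstReturn_of_arcs (w : KWord n) {X : Letter} (hX : X ≠ .A) {m z : ℕ}
    (h : IsArc w.extend X 0 m) (hz : IsArc w.extend (-X) 0 z) (hmz : m < z) :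
    w.IsFirstReturn X m :=
  ⟨hX, h, fun k h0 hk => hz.above k h0 (by omega)⟩

theorem exists_isFirstReturn (w : KWord n) (hn : 0 < 3 * n) : ∃ X m, w.IsFirstReturn X m := by
  obtain ⟨b, hb⟩ := w.exists_arc_of_opener (ε := .B) (by decide) hn w.extend_zero
  obtain ⟨c, hc⟩ := w.exists_arc_of_opener (ε := .C) (by decide) hn w.extend_zero
  rcases lt_trichotomy b c with h | rfl | h
  · exact ⟨.B, b, w.isFirstReturn_of_arcs (by decide) hb hc h⟩
  · exact absurd (hb.closer.symm.trans hc.closer) (by decide)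
  · exact ⟨.C, c, w.isFirstReturn_of_arcs (by decide) hc hb h⟩

theorem IsFirstReturn.tripPerm {w : KWord n} {X : Letter} {m : ℕ} (h : w.IsFirstReturn X m)
    {i : Fin (3 * n)} (hi : (i : ℕ) = 0) : (w.tripPerm i : ℕ) = m := by
  have hZ := Letter.neg_ne_A h.ne_A
  obtain ⟨z, hz⟩ := w.exists_arc_of_opener hZ (hi ▸ i.isLt) w.extend_zero
  have h1 := h.first
  rw [← hi] at h1 hz
  refine w.tripPerm_of_opener h.ne_A h1 hz ?_
  by_contra hle
  have := h.pos (z + 1) (by omega) (by omega)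
  rw [hz.closes, hi] at this
  exact lt_irrefl _ this

/-- The effect of `τ` on words: the letters are exchanged unless an `A` would leave a prefix with
too few `A`'s. -/
theorem tau_letter (L : LinExt (VPoset n) (3 * n)) {k : ℕ} (hk : k + 1 < 3 * n)
    (h : (L.seq ⟨k, by omega⟩).1 ≠ .A ∨ (L.seq ⟨k + 1, hk⟩).1 = .A ∨
      0 < excess (ofLinExt L).extend (L.seq ⟨k + 1, hk⟩).1 k) (j : Fin (3 * n)) :
    ((LinExt.tau (k + 1) L).seq j).1 =
      (L.seq (Equiv.swap ⟨k, by omega⟩ ⟨k + 1, hk⟩ j)).1 := by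
  by_cases heq : (L.seq ⟨k, by omega⟩).1 = (L.seq ⟨k + 1, hk⟩).1
  · have hle : L.seq ⟨k, by omega⟩ ≤ L.seq ⟨k + 1, hk⟩ := by
      refine ⟨Or.inl heq, ?_⟩
      by_contra hlt
      exact L.not_succ_le hk ⟨Or.inl heq.symm, (not_le.mp hlt).le⟩
    rw [L.tau_of_le hk hle, Equiv.swap_apply_def]
    split_ifs with h1 h2
    · rw [h1, heq]
    · rw [h2, heq]
    · rfl
  · rw [L.tau_seq_of_not_le hk]
    rintro ⟨h1 | h1, h2⟩
    · exact heq h1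
    · have h1 : (L.seq ⟨k, by omega⟩).1 = .A := h1
      have hY : (L.seq ⟨k + 1, hk⟩).1 ≠ .A := fun hY => heq (h1.trans hY.symm)
      have h := (h.resolve_left (not_not.mpr h1)).resolve_left hY
      rw [excess_extend _ hY (by omega)] at h
      have c1 := ofLinExt_subscript L ⟨k, by omega⟩
      have c2 := ofLinExt_subscript L ⟨k + 1, hk⟩
      have c3 := prefixCount_succ (ofLinExt L).letter (L.seq ⟨k + 1, hk⟩).1 ⟨k, by omega⟩
      rw [if_neg (show (ofLinExt L).letter ⟨k, by omega⟩ ≠ _ from heq)] at c3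
      have h2 := Fin.le_def.mp h2
      unfold height at h
      rw [h1] at c1
      dsimp only at c1 c2 c3
      omega

theorem tau_letter_of_not (L : LinExt (VPoset n) (3 * n)) {k : ℕ} (hk : k + 1 < 3 * n)
    (h1 : (L.seq ⟨k, by omega⟩).1 = .A) (hY : (L.seq ⟨k + 1, hk⟩).1 ≠ .A)
    (h : excess (ofLinExt L).extend (L.seq ⟨k + 1, hk⟩).1 k ≤ 0) :
    LinExt.tau (k + 1) L = L := by
  refine L.tau_of_le hk ⟨Or.inr h1, ?_⟩
  rw [excess_extend _ hY (by omega)] at h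
  have c1 := ofLinExt_subscript L ⟨k, by omega⟩
  have c2 := ofLinExt_subscript L ⟨k + 1, hk⟩
  have c3 := prefixCount_succ (ofLinExt L).letter (L.seq ⟨k + 1, hk⟩).1 ⟨k, by omega⟩
  rw [if_neg (show (ofLinExt L).letter ⟨k, by omega⟩ ≠ _ from
    fun h => hY (h.symm.trans h1))] at c3
  rw [Fin.le_def]
  unfold height at h
  rw [h1] at c1
  dsimp only at c1 c2 c3
  omega

/-- The letters after the first `m` steps of a promotion. Before the first return `t` an `A` moves
along; there it stays behind in the place before `t`, and the letter `X` moves on. -/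
theorem sweep_letter (L : LinExt (VPoset n) (3 * n)) {X : Letter} {t : ℕ}
    (h : (ofLinExt L).IsFirstReturn X t) {m : ℕ} (hm : m < 3 * n) (i : Fin (3 * n)) :
    ((LinExt.sweep m L).seq i).1 =
      if (i : ℕ) < m then (if (i : ℕ) + 1 = t then .A else (ofLinExt L).extend (i + 1))
      else if (i : ℕ) = m then (if m < t then .A else X)
      else (ofLinExt L).extend i := by
  have ht := h.first.lt
  have htX := h.first.closer
  have hi0 : ∀ j, ((ofLinExt L).letter j) = (L.seq j).1 := fun _ => rfl
  induction m generalizing i with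
  | zero =>
    rw [LinExt.sweep, if_neg (by omega), if_pos ht, ← hi0, ← extend_val]
    split_ifs with h1
    · rw [h1, extend_zero]
    · rfl
  | succ m ih =>
    have ih := fun j => ih (by omega) j
    rw [LinExt.sweep]
    have e1 := ih ⟨m, by omega⟩
    have e2 := ih ⟨m + 1, hm⟩
    simp only [lt_irrefl, if_false, if_true, show ¬ m + 1 < m by omega,
      show m + 1 ≠ m by omega] at e1 e2
    -- the sweep stops moving the letter `A` exactly at the first return
    have hex : m < t → ∀ Y, excess (ofLinExt (LinExt.sweep m L)).extend Y m =
        excess (ofLinExt L).extend Y (m + 1) - 1 := by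
      intro hmt Y
      have hs : ∀ k < m, (ofLinExt (LinExt.sweep m L)).extend k =
          (ofLinExt L).extend (k + 1) := by
        intro k hk
        rw [extend_of_lt _ (show k < 3 * n by omega)]
        have := ih ⟨k, by omega⟩
        rw [if_pos hk, if_neg (by dsimp only; omega)] at this
        exact this
      rw [excess_shift hs Y le_rfl, excess_succ, extend_zero, Letter.weight_A]
      simp [excess]
    by_cases hmt : m + 1 = t
    · have hY : (ofLinExt L).extend (m + 1) = X := by rw [hmt, htX]
      rw [if_pos (by omega)] at e1
      rw [tau_letter_of_not _ hm e1 (by rw [e2, hY]; exact h.ne_A), ih i, hmt]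
      · rcases lt_trichotomy (i : ℕ) m with h1 | h1 | h1
        · rw [if_pos h1, if_pos (show (i : ℕ) < t by omega)]
        · rw [if_neg (by omega), if_pos h1, if_pos (by omega), if_pos (by omega),
            if_pos (by omega)]
        · rw [if_neg (by omega), if_neg (by omega), if_neg (by omega)]
          split_ifs with h2 h3
          · omega
          · rw [h2, htX]
          · rfl
      · rw [e2, hY, hex (by omega)]
        have h1 := excess_succ (ofLinExt L).extend X (m + 1)
        have h2 := h.first.closes
        rw [hY, Letter.weight_self h.ne_A, hmt] at h1
        rw [hmt]
        have h3 : excess (ofLinExt L).extend X 0 = 0 := rfl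
        omega
    · rw [tau_letter _ hm]
      · rcases lt_trichotomy (i : ℕ) m with h1 | h1 | h1
        · rw [Equiv.swap_apply_of_ne_of_ne (by simp [Fin.ext_iff]; omega)
            (by simp [Fin.ext_iff]; omega), ih i, if_pos h1,
            if_pos (show (i : ℕ) < m + 1 by omega)]
        · have hi' : i = ⟨m, by omega⟩ := Fin.ext h1
          rw [hi', Equiv.swap_apply_left, e2, if_pos (by dsimp only; omega), if_neg hmt]
        · by_cases h2 : (i : ℕ) = m + 1
          · have hi' : i = ⟨m + 1, hm⟩ := Fin.ext h2
            rw [hi', Equiv.swap_apply_right, e1]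
            dsimp only
            rw [if_neg (lt_irrefl _), if_pos rfl]
            split_ifs <;> first | rfl | omega
          · rw [Equiv.swap_apply_of_ne_of_ne (by simp [Fin.ext_iff]; omega)
              (by simp [Fin.ext_iff]; omega), ih i]
            rw [if_neg (by omega), if_neg (by omega), if_neg (by omega), if_neg (by omega)]
      · rw [e1, e2]
        by_cases h1 : m < t
        · rw [if_pos h1]
          right
          by_cases hY : (ofLinExt L).extend (m + 1) = .A
          · exact Or.inl hY
          · right
            rw [hex h1]
            have h2 := excess_succ (ofLinExt L).extend ((ofLinExt L).extend (m + 1)) (m + 1)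
            rw [Letter.weight_self hY] at h2
            have h3 : 0 < excess (ofLinExt L).extend ((ofLinExt L).extend (m + 1)) (m + 1 + 1) := by
              rcases Letter.eq_or_eq_neg h.ne_A hY with h3 | h3 <;> rw [h3]
              · exact h.first.above _ (by omega) (by omega)
              · exact h.pos _ (by omega) (by omega)
            omega
        · rw [if_neg h1]
          exact Or.inl h.ne_A

theorem promotion_letter (w : KWord n) {X : Letter} {t : ℕ} (h : w.IsFirstReturn X t)
    (i : Fin (3 * n)) : w.promotion.letter i =
      if (i : ℕ) + 1 = 3 * n then X else if (i : ℕ) + 1 = t then .A else w.extend (i + 1) := by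
  have hi := i.isLt
  have hL : ofLinExt ((linExtEquiv n).symm w) = w := (linExtEquiv n).apply_symm_apply w
  have := sweep_letter ((linExtEquiv n).symm w) (hL.symm ▸ h) (m := 3 * n - 1) (by omega) i
  rw [hL] at this
  have ht := w.arc_lt h.ne_A h.first
  refine this.trans ?_
  by_cases h1 : (i : ℕ) + 1 = 3 * n
  · rw [if_neg (by omega), if_pos (by omega), if_neg (by omega), if_pos h1]
  · rw [if_pos (by omega), if_neg h1]

theorem evac_letter (w : KWord n) (i : Fin (3 * n)) {X : Letter} {t : ℕ}
    (h : (promotion^[3 * n - 1 - i] w).IsFirstReturn X t) :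
    w.evac.letter i = if (i : ℕ) < t then .A else X := by
  have hL : ofLinExt ((linExtEquiv n).symm (promotion^[3 * n - 1 - i] w)) =
      promotion^[3 * n - 1 - i] w := (linExtEquiv n).apply_symm_apply _
  have := sweep_letter _ (hL.symm ▸ h) i.isLt i
  rw [symm_iterate_promotion, ← LinExt.evac_seq, if_neg (lt_irrefl _), if_pos rfl] at this
  exact this

end KWord

/-! ### Trips and letters under iterated promotion -/

theorem iterate_finRotate_val {N k : ℕ} (hk : k < N) (x : Fin N) :
    ((finRotate N)^[k] x : ℕ) = if (x : ℕ) + k < N then (x : ℕ) + k else x + k - N := by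
  induction k with
  | zero => simp
  | succ k ih =>
    have := x.isLt
    rw [Function.iterate_succ_apply', finRotate_val, ih (by omega)]
    split_ifs <;> omega

theorem finRotate_rev_finRotate {N : ℕ} (x : Fin N) :
    finRotate N (Fin.rev (finRotate N x)) = Fin.rev x := by
  apply Fin.ext
  have := x.isLt
  rw [finRotate_val, Fin.val_rev, Fin.val_rev, finRotate_val]
  split_ifs <;> omega

namespace KWord

variable {n : ℕ}

theorem tripPerm_promotion (w : KWord n) (k : Fin (3 * n)) :
    finRotate _ (w.promotion.tripPerm k) = w.tripPerm (finRotate _ k) := by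
  obtain ⟨X, m, h⟩ := w.exists_isFirstReturn (by have := k.isLt; omega)
  have hm := w.arc_lt h.ne_A h.first
  have hm0 := h.first.lt
  let f' : ℕ → Letter := fun k =>
    if k = 0 ∨ k = 3 * n then X else if k = m then .A else w.extend k
  have P : Promotes w.extend f' X m (3 * n) :=
    { ne_A := h.ne_A
      first := h.first
      lt := hm
      nonneg := fun ε hε k hk => w.excess_nonneg hε hk
      total := fun ε hε => w.excess_total hε
      pos := h.pos
      tail := fun k hk => dif_neg (not_lt.mpr hk)
      zero' := if_pos (Or.inl rfl)
      turn' := by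
        show (if m = 0 ∨ m = 3 * n then X else if m = m then .A else w.extend m) = .A
        rw [if_neg (by omega), if_pos rfl]
      last' := if_pos (Or.inr rfl)
      else' := fun k h1 h2 h3 => by
        show (if k = 0 ∨ k = 3 * n then X else if k = m then .A else w.extend k) = w.extend k
        rw [if_neg (by omega), if_neg h2] }
  refine P.tripPerm_rotate (u := w.promotion) (fun k hk => ?_) k
  rw [extend_of_lt _ hk, w.promotion_letter h]
  simp [f']

theorem tripPerm_iterate (w : KWord n) (k : ℕ) (i : Fin (3 * n)) :
    (finRotate _)^[k] ((promotion^[k] w).tripPerm i) = w.tripPerm ((finRotate _)^[k] i) := by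
  induction k generalizing i with
  | zero => rfl
  | succ k ih =>
    rw [Function.iterate_succ_apply' promotion, Function.iterate_succ_apply (finRotate _),
      tripPerm_promotion, ih, ← Function.iterate_succ_apply]

/-- The first return of the `k`-fold promotion is the end of the trip from `k`. -/
theorem IsFirstReturn.tripPerm_iterate {w : KWord n} {X : Letter} {t : ℕ} {k : Fin (3 * n)}
    (h : (promotion^[k] w).IsFirstReturn X t) :
    (w.tripPerm k : ℕ) = if t + k < 3 * n then t + k else t + k - 3 * n := by
  have hk := k.isLt
  have h1 := w.tripPerm_iterate k ⟨0, by omega⟩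
  have h2 : (finRotate (3 * n))^[(k : ℕ)] ⟨0, by omega⟩ = k := by
    apply Fin.ext
    rw [iterate_finRotate_val hk]
    simp
  rw [h2] at h1
  rw [← h1, iterate_finRotate_val hk, h.tripPerm rfl]

/-- As long as a letter has not left the front of the word, it is changed by promotion only when
the trip that ends there begins at the front. -/
theorem letter_iterate (w : KWord n) {k : ℕ} {i j : Fin (3 * n)} (hij : (i : ℕ) + k = j) :
    (promotion^[k] w).letter i =
      if (w.tripPerm.symm j : ℕ) < k then .A else w.letter j := by
  have hj := j.isLt
  induction k generalizing i with
  | zero => rw [if_neg (by omega), show i = j from Fin.ext hij]; rfl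
  | succ k ih =>
    obtain ⟨X, t, h⟩ := (promotion^[k] w).exists_isFirstReturn (by omega)
    have ht := KWord.arc_lt _ h.ne_A h.first
    have htr := IsFirstReturn.tripPerm_iterate (w := w) (k := ⟨k, by omega⟩) h
    have hiff : (i : ℕ) + 1 = t ↔ (w.tripPerm.symm j : ℕ) = k := by
      constructor
      · intro hit
        have : w.tripPerm ⟨k, by omega⟩ = j := by
          apply Fin.ext
          rw [htr, if_pos (by dsimp only; omega)]
          dsimp only
          omega
        rw [← this, Equiv.symm_apply_apply]
      · intro hk
        have : w.tripPerm ⟨k, by omega⟩ = j := by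
          rw [← Equiv.eq_symm_apply]
          exact Fin.ext hk.symm
        rw [this] at htr
        dsimp only at htr
        split_ifs at htr <;> omega
    rw [Function.iterate_succ_apply', promotion_letter _ h, if_neg (by omega),
      extend_of_lt _ (by omega), ih (i := ⟨i + 1, by omega⟩) (by dsimp only; omega)]
    split_ifs <;> first | rfl | omega

theorem tripPerm_ne (w : KWord n) (k : Fin (3 * n)) : w.tripPerm k ≠ k := by
  intro hk
  have := k.isLt
  obtain ⟨X, t, h⟩ := (promotion^[k] w).exists_isFirstReturn (by omega)
  have ht := KWord.arc_lt _ h.ne_A h.first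
  have ht0 := h.first.lt
  have htr := IsFirstReturn.tripPerm_iterate (w := w) (k := k) h
  rw [hk] at htr
  split_ifs at htr <;> omega

/-- The openers are the ends of the trips that come from the right. -/
theorem letter_tripPerm_eq_A_iff (w : KWord n) (k : Fin (3 * n)) :
    w.letter (w.tripPerm k) = .A ↔ w.tripPerm k < k := by
  have hkl := k.isLt
  have hjl := (w.tripPerm k).isLt
  have hne : (w.tripPerm k : ℕ) ≠ k := fun h => w.tripPerm_ne k (Fin.ext h)
  constructor
  · intro hA
    by_contra hlt
    rw [Fin.lt_def] at hlt
    obtain ⟨X, t, h⟩ := (promotion^[k] w).exists_isFirstReturn (by omega)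
    have ht := KWord.arc_lt _ h.ne_A h.first
    have htr := IsFirstReturn.tripPerm_iterate (w := w) (k := k) h
    have hl := w.letter_iterate (k := k) (i := ⟨t, ht⟩) (j := w.tripPerm k)
      (by dsimp only; split_ifs at htr <;> omega)
    rw [Equiv.symm_apply_apply, if_neg (lt_irrefl _), hA, ← extend_val] at hl
    exact h.ne_A (h.first.closer.symm.trans hl)
  · intro hlt
    rw [Fin.lt_def] at hlt
    have hl := w.letter_iterate (k := w.tripPerm k) (i := ⟨0, by omega⟩) (j := w.tripPerm k)
      (Nat.zero_add _)
    rw [Equiv.symm_apply_apply, if_neg (by omega), ← extend_val] at hl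
    rw [← hl]
    exact extend_zero _

theorem evac_letter_eq (w : KWord n) (i : Fin (3 * n)) :
    w.evac.letter i = w.letter (w.tripPerm (Fin.rev i)) := by
  have hi := i.isLt
  have hr : ((Fin.rev i : Fin (3 * n)) : ℕ) = 3 * n - 1 - i := by
    rw [Fin.val_rev]
    omega
  obtain ⟨X, t, h⟩ := (promotion^[3 * n - 1 - i] w).exists_isFirstReturn (by omega)
  have ht := KWord.arc_lt _ h.ne_A h.first
  rw [w.evac_letter i h]
  rw [← hr] at h
  have htr := IsFirstReturn.tripPerm_iterate (w := w) (k := Fin.rev i) h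
  by_cases hit : (i : ℕ) < t
  · rw [if_pos hit, eq_comm, letter_tripPerm_eq_A_iff, Fin.lt_def, htr]
    split_ifs <;> omega
  · rw [if_neg hit]
    have hl := w.letter_iterate (k := (Fin.rev i : Fin (3 * n))) (i := ⟨t, ht⟩)
      (j := w.tripPerm (Fin.rev i)) (by dsimp only; split_ifs at htr <;> omega)
    rw [Equiv.symm_apply_apply, if_neg (lt_irrefl _), ← extend_val] at hl
    exact h.first.closer.symm.trans hl

/-! ### The trip permutation of the evacuation -/

theorem lt_tripPerm_evac_symm_iff (w : KWord n) (x : Fin (3 * n)) :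
    x < w.evac.tripPerm.symm x ↔ x < Fin.rev (w.tripPerm (Fin.rev x)) := by
  have h := w.evac.letter_tripPerm_eq_A_iff (w.evac.tripPerm.symm x)
  rw [Equiv.apply_symm_apply] at h
  rw [← h, evac_letter_eq, letter_tripPerm_eq_A_iff, Fin.lt_rev_iff]

/-- Simultaneous rotation: promoting `w` rotates both permutations in the same direction. -/
theorem iterate_lt_iff (w : KWord n) (k : ℕ) (x : Fin (3 * n)) :
    (finRotate _)^[k] x < (finRotate _)^[k] (w.evac.tripPerm.symm x) ↔
      (finRotate _)^[k] x < (finRotate _)^[k] (Fin.rev (w.tripPerm (Fin.rev x))) := by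
  induction k generalizing w x with
  | zero => exact w.lt_tripPerm_evac_symm_iff x
  | succ k ih =>
    have h1 : w.promotion.evac.tripPerm.symm (finRotate _ x) =
        finRotate _ (w.evac.tripPerm.symm x) := by
      rw [Equiv.symm_apply_eq, ← tripPerm_promotion, promotion_evac_promotion,
        Equiv.apply_symm_apply]
    have h2 : Fin.rev (w.promotion.tripPerm (Fin.rev (finRotate _ x))) =
        finRotate _ (Fin.rev (w.tripPerm (Fin.rev x))) := by
      rw [← finRotate_rev_finRotate (w.promotion.tripPerm _), tripPerm_promotion,
        finRotate_rev_finRotate]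
    have := ih w.promotion (finRotate _ x)
    rwa [h1, h2] at this

theorem tripPerm_evac_symm (w : KWord n) (x : Fin (3 * n)) :
    w.evac.tripPerm.symm x = Fin.rev (w.tripPerm (Fin.rev x)) := by
  have hxy : x ≠ w.evac.tripPerm.symm x := fun h =>
    w.evac.tripPerm_ne x (by rw [Equiv.eq_symm_apply] at h; exact h)
  have hiff := fun k => w.iterate_lt_iff k x
  generalize w.evac.tripPerm.symm x = y at hxy hiff ⊢
  generalize Fin.rev (w.tripPerm (Fin.rev x)) = z at hiff ⊢
  by_contra hyz
  -- rotate `y` to the last place, and then once more to the first one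
  obtain ⟨k, hk⟩ : ∃ k, k = 3 * n - 1 - (y : ℕ) := ⟨_, rfl⟩
  have hy := y.isLt
  have h0 := hiff k
  have h1 := hiff (k + 1)
  have hinj : Function.Injective (finRotate (3 * n))^[k] := (finRotate _).injective.iterate k
  have hY : ((finRotate (3 * n))^[k] y : ℕ) = 3 * n - 1 := by
    rw [iterate_finRotate_val (by omega), if_pos (by omega)]
    omega
  have hX : ((finRotate (3 * n))^[k] x : ℕ) ≠ (finRotate (3 * n))^[k] y :=
    fun h => hxy (hinj (Fin.ext h))
  have hZ : ((finRotate (3 * n))^[k] z : ℕ) ≠ (finRotate (3 * n))^[k] y :=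
    fun h => hyz (hinj (Fin.ext h)).symm
  simp only [Function.iterate_succ_apply', Fin.lt_def, finRotate_val] at h0 h1
  have := ((finRotate (3 * n))^[k] x).isLt
  have := ((finRotate (3 * n))^[k] z).isLt
  rw [if_neg (by omega), if_pos (by omega), if_neg (by omega)] at h1
  omega

theorem tripPerm_evac (w : KWord n) :
    w.evac.tripPerm = reverseComplement w.tripPerm⁻¹ := by
  ext1 i
  have h := w.tripPerm_evac_symm (Fin.rev (w.tripPerm.symm (Fin.rev i)))
  rw [Fin.rev_rev, Equiv.apply_symm_apply, Fin.rev_rev, Equiv.symm_apply_eq] at h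
  exact h.symm

theorem eps_evac (w : KWord n) (i : Fin (3 * n)) : w.evac.eps i = -w.eps (Fin.rev i) := by
  by_cases hi : w.evac.letter i = .A
  · have h1 := w.evac.letter_tripPerm_of_opener hi
    have h2 : w.evac.letter (w.evac.tripPerm i) = w.letter (Fin.rev i) := by
      rw [evac_letter_eq, tripPerm_evac]
      simp [reverseComplement]
    rw [eps, if_pos h1, h2]
    rw [h2] at h1
    rw [w.eps_of_closer h1, Letter.neg_neg']
  · rw [w.evac.eps_of_closer hi]
    rw [evac_letter_eq] at hi ⊢
    rw [eps, if_pos hi]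

end KWord

theorem mainTheorem5 (n : ℕ) (w : KWord n) :
    (∀ i : Fin (3 * n), w.evac.letter i = w.letter (w.tripPerm (Fin.rev i))) ∧
    w.evac.tripPerm = reverseComplement w.tripPerm⁻¹ ∧
    (∀ i : Fin (3 * n), w.evac.eps i = -w.eps (Fin.rev i)) :=
  ⟨w.evac_letter_eq, w.tripPerm_evac, w.eps_evac⟩
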